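/- Let $k$ be a field of characteristic $2$ containing $\mathbb F_4=\{0,1,j,j^2\}$ (so $j\in k$ and $j^2+j+1=0$), and let $n\ge 3$. Let $\Gamma_n$ be the quotient of the braid group on $n$ strands, with standard generators $s_1,\dots,s_{n-1}$, by the relations $s_i^3=1$. For $\alpha,\beta\in k$ let $J_n(\alpha,\beta)$ be the two-sided ideal of the group algebra $k\Gamma_n$ generated by $(s_1-\alpha)(s_1-\beta)$, let $H_n(\alpha,\beta)=k\Gamma_n/J_n(\alpha,\beta)$, and let $J_n=J_n(1,j)\cap J_n(1,j^2)\cap J_n(j,j^2)$. Let $$\mathbf b=s_1s_2^{-1}+s_2^{-1}s_1+s_1^{-1}s_2+s_2s_1^{-1},$$ $$\mathbf q=1+s_1s_2^2+s_2s_1^2+s_1^2s_2+s_2^2s_1+s_1s_2s_1+s_1^2s_2^2s_1^2+s_1s_2^2s_1s_2^2,$$ and let $K_n$ (over $k$) be the quotient of $k\Gamma_n$ by the two-sided ideal generated by $\mathbf q$. For distinct cube roots of unity $\alpha,\beta$ and $\gamma\in\{\alpha,\beta\}$ let $q_\gamma:H_n(\alpha,\beta)\to k$ be the algebra homomorphism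 sending every $s_i$ to $\gamma$. Let $\mathcal H_n$ be the subalgebra of $H_n(j,j^2)\times H_n(1,j^2)\times H_n(1,j)$ consisting of the triples $(x_1,x_j,x_{j^2})$ with $q_1(x_j)=q_1(x_{j^2})$, $q_j(x_1)=q_j(x_{j^2})$ and $q_{j^2}(x_1)=q_{j^2}(x_j)$. Then: 1. $J_n$ is the two-sided ideal of $k\Gamma_n$ generated by $\mathbf b$, and $\dim_k k\Gamma_n/J_n=3(n!-1)$. 2. The natural map $k\Gamma_n/J_n\to H_n(j,j^2)\times H_n(1,j^2)\times H_n(1,j)$ is injective with image $\mathcal H_n$; so $k\Gamma_n/J_n\cong\mathcal H_n$ and $\dim_k\mathcal H_n=3(n!-1)$. 3. The natural map $k\Gamma_n\to\mathcal H_n$, $x\mapsto(x,x,x)$, factors through a surjective algebra homomorphism $K_n\to\mathcal H_n$. -/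

import Mathlib

namespace TernaryHecke

/-- The relators of `Γ_n` on the generators `s_1, …, s_{n-1}` (the generator `s_{i+1}` is indexed by
`i : Fin (n - 1)`): the far commutation and braid relations of the braid group on `n` strands,
and `s_i ^ 3 = 1`. -/
inductive Rel (n : ℕ) : FreeGroup (Fin (n - 1)) → Prop
  | comm (i i' : Fin (n - 1)) (h : (i : ℕ) + 1 < i') :
      Rel n (FreeGroup.of i * FreeGroup.of i' * (FreeGroup.of i' * FreeGroup.of i)⁻¹)
  | braid (i i' : Fin (n - 1)) (h : (i : ℕ) + 1 = i') :
      Rel n (FreeGroup.of i * FreeGroup.of i' * FreeGroup.of i *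
        (FreeGroup.of i' * FreeGroup.of i * FreeGroup.of i')⁻¹)
  | cube (i : Fin (n - 1)) : Rel n (FreeGroup.of i ^ 3)

/-- The group `Γ_n`: the braid group `B_n` on `n` strands modulo the relations `s_i ^ 3 = 1`. -/
abbrev Γ (n : ℕ) : Type := PresentedGroup {r | Rel n r}

/-- The generator `s_{i+1}` of `Γ_n`. -/
abbrev gen (n : ℕ) (i : Fin (n - 1)) : Γ n := PresentedGroup.of i

/-- The first standard generator of `Γ_n`, for `n ≥ 3`. -/
abbrev s₁ {n : ℕ} (hn : 3 ≤ n) : Γ n := gen n ⟨0, by omega⟩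

/-- The second standard generator of `Γ_n`, for `n ≥ 3`. -/
abbrev s₂ {n : ℕ} (hn : 3 ≤ n) : Γ n := gen n ⟨1, by omega⟩

noncomputable section

variable (k : Type*) [CommRing k]

/-- The quotient of a `k`-algebra by a two-sided ideal. -/
abbrev QuotAlg {A : Type*} [Ring A] (I : TwoSidedIdeal A) : Type _ := I.ringCon.Quotient

/-- The quotient map of a `k`-algebra by a two-sided ideal. -/
abbrev quotMk {A : Type*} [Ring A] [Algebra k A] (I : TwoSidedIdeal A) : A →ₐ[k] QuotAlg I :=
  I.ringCon.mkₐ k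

/-- A `k`-algebra homomorphism vanishing on a two-sided ideal factors through the quotient. -/
def quotLift {A B : Type*} [Ring A] [Algebra k A] [Ring B] [Algebra k B] (I : TwoSidedIdeal A)
    (f : A →ₐ[k] B) (h : ∀ x ∈ I, f x = 0) : QuotAlg I →ₐ[k] B :=
  I.ringCon.liftₐ f fun x y hxy => by
    have hx := h _ ((I.rel_iff x y).1 hxy)
    rw [map_sub, sub_eq_zero] at hx
    exact hx

/-- The image of a group element in the group algebra `kΓ_n`. -/
abbrev toAlg {n : ℕ} (g : Γ n) : MonoidAlgebra k (Γ n) := MonoidAlgebra.of k (Γ n) g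

/-- `b = s₁ s₂⁻¹ + s₂⁻¹ s₁ + s₁⁻¹ s₂ + s₂ s₁⁻¹`. -/
def b {n : ℕ} (hn : 3 ≤ n) : MonoidAlgebra k (Γ n) :=
  toAlg k (s₁ hn * (s₂ hn)⁻¹) + toAlg k ((s₂ hn)⁻¹ * s₁ hn) +
    toAlg k ((s₁ hn)⁻¹ * s₂ hn) + toAlg k (s₂ hn * (s₁ hn)⁻¹)

/-- `q = 1 + s₁ s₂² + s₂ s₁² + s₁² s₂ + s₂² s₁ + s₁ s₂ s₁ + s₁² s₂² s₁² + s₁ s₂² s₁ s₂²`, the sum of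
the elements of the quaternion subgroup of `Γ_3`. -/
def q {n : ℕ} (hn : 3 ≤ n) : MonoidAlgebra k (Γ n) :=
  1 + toAlg k (s₁ hn * s₂ hn ^ 2) + toAlg k (s₂ hn * s₁ hn ^ 2) +
    toAlg k (s₁ hn ^ 2 * s₂ hn) + toAlg k (s₂ hn ^ 2 * s₁ hn) +
    toAlg k (s₁ hn * s₂ hn * s₁ hn) + toAlg k (s₁ hn ^ 2 * s₂ hn ^ 2 * s₁ hn ^ 2) +
    toAlg k (s₁ hn * s₂ hn ^ 2 * s₁ hn * s₂ hn ^ 2)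

/-- The algebra `K_n` over `k`: the quotient of `kΓ_n` by the two-sided ideal generated by `q`. -/
abbrev K {n : ℕ} (hn : 3 ≤ n) : Type _ := QuotAlg (TwoSidedIdeal.span {q k hn})

variable {k}

/-- The Hecke ideal `J_n(α, β)`: the two-sided ideal of `kΓ_n` generated by
`(s₁ - α) (s₁ - β)`. -/
def heckeIdeal {n : ℕ} (hn : 3 ≤ n) (α β : k) : TwoSidedIdeal (MonoidAlgebra k (Γ n)) :=
  TwoSidedIdeal.span
    {(toAlg k (s₁ hn) - algebraMap k _ α) * (toAlg k (s₁ hn) - algebraMap k _ β)}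

/-- The Hecke algebra `H_n(α, β) = kΓ_n / J_n(α, β)`. -/
abbrev Hecke {n : ℕ} (hn : 3 ≤ n) (α β : k) : Type _ := QuotAlg (heckeIdeal hn α β)

/-- The intersection `J_n` of the three Hecke ideals at the pairs of distinct elements of
`{1, j, j²}`. -/
def J {n : ℕ} (hn : 3 ≤ n) (j : k) : TwoSidedIdeal (MonoidAlgebra k (Γ n)) :=
  heckeIdeal hn 1 j ⊓ heckeIdeal hn 1 (j ^ 2) ⊓ heckeIdeal hn j (j ^ 2)

/-- The character `Γ_n → kˣ` sending each generator to the cube root of unity `γ`. -/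
def groupChar (n : ℕ) (γ : k) (hγ : γ ^ 3 = 1) : Γ n →* kˣ :=
  PresentedGroup.toGroup (f := fun _ => Units.ofPowEqOne γ 3 hγ (by norm_num)) <| by
    rintro _ (⟨i, i', -⟩ | ⟨i, i', -⟩ | i)
    · simp
    · simp
    · ext
      simp

/-- The one-dimensional representation of `kΓ_n` sending each generator to `γ`. -/
def algChar (n : ℕ) (γ : k) (hγ : γ ^ 3 = 1) : MonoidAlgebra k (Γ n) →ₐ[k] k :=
  MonoidAlgebra.lift k k (Γ n) ((Units.coeHom k).comp (groupChar n γ hγ))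

theorem algChar_gen {n : ℕ} (γ : k) (hγ : γ ^ 3 = 1) (i : Fin (n - 1)) :
    algChar n γ hγ (toAlg k (gen n i)) = γ := by
  simp [algChar, groupChar]

theorem algChar_eq_zero {n : ℕ} (hn : 3 ≤ n) (α β γ : k) (hγ : γ ^ 3 = 1)
    (hroot : (γ - α) * (γ - β) = 0) (x : MonoidAlgebra k (Γ n)) (hx : x ∈ heckeIdeal hn α β) :
    algChar n γ hγ x = 0 := by
  have h : heckeIdeal hn α β ≤ TwoSidedIdeal.ker (algChar n γ hγ) := by
    refine TwoSidedIdeal.span_le.2 ?_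
    rintro _ rfl
    rw [SetLike.mem_coe, TwoSidedIdeal.mem_ker, map_mul, map_sub, map_sub, algChar_gen,
      AlgHom.commutes, AlgHom.commutes]
    exact hroot
  exact (TwoSidedIdeal.mem_ker _).1 (h hx)

/-- The one-dimensional quotient `q_γ : H_n(α, β) → k` sending each `s_i` to `γ`, where `γ` is a
cube root of unity which is `α` or `β`. -/
def heckeChar {n : ℕ} (hn : 3 ≤ n) (α β γ : k) (hγ : γ ^ 3 = 1)
    (hroot : (γ - α) * (γ - β) = 0) : Hecke hn α β →ₐ[k] k :=
  quotLift k (heckeIdeal hn α β) (algChar n γ hγ) (algChar_eq_zero hn α β γ hγ hroot)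

/-- The product `H_n(j, j²) × H_n(1, j²) × H_n(1, j)`. -/
abbrev HeckeProd {n : ℕ} (hn : 3 ≤ n) (j : k) : Type _ :=
  Hecke hn j (j ^ 2) × Hecke hn 1 (j ^ 2) × Hecke hn 1 j

theorem cube_eq_one {j : k} (hj : j ^ 2 + j + 1 = 0) : j ^ 3 = 1 := by
  linear_combination (j - 1) * hj

theorem sq_cube_eq_one {j : k} (hj : j ^ 2 + j + 1 = 0) : (j ^ 2) ^ 3 = 1 := by
  rw [← pow_mul, mul_comm, pow_mul, cube_eq_one hj, one_pow]

/-- The ternary Hecke algebra `𝓗_n`: the triples `(x, y, z)` in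
`H_n(j, j²) × H_n(1, j²) × H_n(1, j)` whose components agree under the common one-dimensional
quotients: `q_1 y = q_1 z`, `q_j x = q_j z` and `q_{j²} x = q_{j²} y`. -/
def ternaryHecke {n : ℕ} (hn : 3 ≤ n) (j : k) (hj : j ^ 2 + j + 1 = 0) :
    Subalgebra k (HeckeProd hn j) where
  carrier := {t |
    heckeChar hn 1 (j ^ 2) 1 (one_pow 3) (by simp) t.2.1 =
      heckeChar hn 1 j 1 (one_pow 3) (by simp) t.2.2 ∧
    heckeChar hn j (j ^ 2) j (cube_eq_one hj) (by simp) t.1 =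
      heckeChar hn 1 j j (cube_eq_one hj) (by simp) t.2.2 ∧
    heckeChar hn j (j ^ 2) (j ^ 2) (sq_cube_eq_one hj) (by simp) t.1 =
      heckeChar hn 1 (j ^ 2) (j ^ 2) (sq_cube_eq_one hj) (by simp) t.2.1}
  mul_mem' := by
    rintro s t ⟨h1, h2, h3⟩ ⟨g1, g2, g3⟩
    refine ⟨?_, ?_, ?_⟩ <;> simp only [Prod.fst_mul, Prod.snd_mul, map_mul, *]
  add_mem' := by
    rintro s t ⟨h1, h2, h3⟩ ⟨g1, g2, g3⟩
    refine ⟨?_, ?_, ?_⟩ <;> simp only [Prod.fst_add, Prod.snd_add, map_add, *]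
  algebraMap_mem' r := by
    refine ⟨?_, ?_, ?_⟩ <;>
      simp only [Prod.algebraMap_apply, AlgHom.commutes]

/-- The diagonal map `kΓ_n → H_n(j, j²) × H_n(1, j²) × H_n(1, j)`, `x ↦ (x, x, x)`. -/
def diag {n : ℕ} (hn : 3 ≤ n) (j : k) : MonoidAlgebra k (Γ n) →ₐ[k] HeckeProd hn j :=
  (quotMk k (heckeIdeal hn j (j ^ 2))).prod
    ((quotMk k (heckeIdeal hn 1 (j ^ 2))).prod (quotMk k (heckeIdeal hn 1 j)))

theorem quotMk_eq_zero {A : Type*} [Ring A] [Algebra k A] (I : TwoSidedIdeal A) {x : A}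
    (hx : x ∈ I) : quotMk k I x = 0 :=
  (RingCon.eq I.ringCon).2 ((I.mem_iff x).1 hx)

theorem diag_eq_zero {n : ℕ} (hn : 3 ≤ n) (j : k) (x : MonoidAlgebra k (Γ n))
    (hx : x ∈ J hn j) : diag hn j x = 0 := by
  rw [J, TwoSidedIdeal.mem_inf, TwoSidedIdeal.mem_inf] at hx
  exact Prod.ext (quotMk_eq_zero _ hx.2)
    (Prod.ext (quotMk_eq_zero _ hx.1.2) (quotMk_eq_zero _ hx.1.1))

/-- The natural map `kΓ_n / J_n → H_n(j, j²) × H_n(1, j²) × H_n(1, j)`. -/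
def natMap {n : ℕ} (hn : 3 ≤ n) (j : k) : QuotAlg (J hn j) →ₐ[k] HeckeProd hn j :=
  quotLift k (J hn j) (diag hn j) (diag_eq_zero hn j)

end

end TernaryHecke

namespace TernaryHecke

/-! In characteristic 2 the relation s³ = 1 makes s diagonalisable, and `eigIdem a s` = 1 + a²s +
as² (written E_a(s)) projects onto the eigenvalue a. For {a, b, c} = {1, j, j²} the Hecke ideal of
(a, b) is generated by E_c(s₁) (`heckeIdeal_eq_span`), so J_n is the intersection of three ideals,
each generated by one projection.

J_n ⊆ (**b**) rests on two facts. Modulo E_a(s₁)E_c(s₂) and E_c(s₁)E_a(s₂), the eigenvalue c can be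
merged into b without losing the braid relations. This gives a second homomorphism from kΓ_n, equal
to the quotient map on (E_a(s₁)) and zero on (E_c(s₁)); hence (E_a(s₁)) ∩ (E_c(s₁)) lies in the
ideal generated by the two products (`span_inf_span_le`). Secondly, modulo **b** all
E_a(s)E_b(t)E_c(s) with s, t neighbours and a, b, c distinct vanish, and this forces E_b(s₁) to
annihilate that ideal from the left (`eigIdem_mul_mem_span_b`). An x in J_n is the sum of its three
projections, and each is thus zero modulo **b** (`inf_eq_span_b`). The reverse inclusion is a
computation with quadratic generators.

For the image, the kernel of the character with value a is the sum of the two Hecke ideals involving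
a, and a weak distributive law for the three Hecke ideals (`exists_add_of_algChar_eq_zero`) gives a
Chinese remainder argument (`exists_diag_eq`). Each Hecke algebra has dimension n! (`finrank_hecke`)
and the three gluing conditions are independent, whence 3n! - 3. Finally **q** lies in every Hecke
ideal, so the diagonal map factors through K_n. -/

/-- `a`, `b`, `c` are the three cube roots of unity, in some order, in characteristic two. -/
structure CubeRoots {k : Type*} [CommRing k] (a b c : k) : Prop where
  two : (2 : k) = 0
  sum : a + b + c = 0
  prod_ab : a * b = c ^ 2
  prod_bc : b * c = a ^ 2
  prod_ca : c * a = b ^ 2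
  cube_a : a ^ 3 = 1
  cube_b : b ^ 3 = 1
  cube_c : c ^ 3 = 1

/-- For `s ^ 3 = 1` and `a ^ 3 = 1` in characteristic two, the idempotent projecting onto the
`a`-eigenspace of `s`. -/
def eigIdem {k R : Type*} [CommRing k] [Ring R] [Algebra k R] (a : k) (s : R) : R :=
  1 + a ^ 2 • s + a • s ^ 2

/-! ### Eigenprojections of one generator and of two neighbours -/

section Eigen

variable {k R : Type*} [CommRing k] [Ring R] [Algebra k R] {a b c : k} {s t r : R}

local notation "E" => eigIdem

namespace CubeRoots

theorem rotate (h : CubeRoots a b c) : CubeRoots b c a :=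
  ⟨h.two, by linear_combination h.sum, h.prod_bc, h.prod_ca, h.prod_ab, h.cube_b, h.cube_c,
    h.cube_a⟩

theorem swap (h : CubeRoots a b c) : CubeRoots b a c :=
  ⟨h.two, by linear_combination h.sum, by linear_combination h.prod_ab,
    by linear_combination h.prod_ca, by linear_combination h.prod_bc, h.cube_b, h.cube_a,
    h.cube_c⟩

theorem sub_ab (h : CubeRoots a b c) : a - b = c := by
  linear_combination h.sum - (c + b) * h.two

theorem add_self (h : CubeRoots a b c) (x : R) : x + x = 0 := by
  rw [← two_smul k, h.two, zero_smul]

theorem neg_eq (h : CubeRoots a b c) (x : R) : -x = x :=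
  (eq_neg_of_add_eq_zero_left (h.add_self x)).symm

theorem eq_of_add_eq_zero (h : CubeRoots a b c) {x y : R} (hxy : x + y = 0) : x = y := by
  rw [eq_neg_of_add_eq_zero_left hxy, h.neg_eq]

theorem smul_cancel (h : CubeRoots a b c) {x : R} (hx : a • x = b • x) : x = 0 := by
  have h1 : c • x = 0 := by rw [← h.sub_ab, sub_smul, hx, sub_self]
  rw [← one_smul k x, ← h.cube_c, pow_succ, mul_smul, h1, smul_zero]

end CubeRoots

theorem eigIdem_add (h : CubeRoots a b c) (s : R) : E a s + E b s + E c s = 1 := by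
  unfold eigIdem
  match_scalars
  · linear_combination h.two
  · grind [h.two, h.sum, h.prod_ab, h.prod_bc, h.prod_ca]
  · linear_combination h.sum

theorem mul_eigIdem (ha : a ^ 3 = 1) (hs : s ^ 3 = 1) : s * E a s = a • E a s := by
  have h1 : s * E a s = s + a ^ 2 • s ^ 2 + a • s ^ 3 := by
    unfold eigIdem
    simp only [mul_add, mul_smul_comm, mul_one, pow_succ, pow_zero, one_mul, mul_assoc]
  rw [h1, hs, eigIdem]
  match_scalars <;> grind

theorem eigIdem_mul (ha : a ^ 3 = 1) (hs : s ^ 3 = 1) : E a s * s = a • E a s := by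
  rw [← mul_eigIdem ha hs]
  unfold eigIdem
  simp only [mul_add, add_mul, mul_smul_comm, smul_mul_assoc, mul_one, one_mul, pow_succ, pow_zero,
    mul_assoc]

theorem eigIdem_mul_eigIdem (ha : a ^ 3 = 1) (hs : s ^ 3 = 1) (b : k) :
    E b s * E a s = (1 + b ^ 2 * a + b * a ^ 2) • E a s := by
  have h2 : s ^ 2 * E a s = (a ^ 2) • E a s := by
    rw [pow_two, mul_assoc, mul_eigIdem ha hs, mul_smul_comm, mul_eigIdem ha hs, smul_smul,
      ← pow_two]
  conv_lhs => rw [eigIdem]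
  rw [add_mul, add_mul, smul_mul_assoc, smul_mul_assoc, h2, mul_eigIdem ha hs, one_mul]
  module

theorem eigIdem_idem (h : CubeRoots a b c) (hs : s ^ 3 = 1) : E a s * E a s = E a s := by
  rw [eigIdem_mul_eigIdem h.cube_a hs]
  have : 1 + a ^ 2 * a + a * a ^ 2 = 1 := by linear_combination a ^ 3 * h.two
  rw [this, one_smul]

theorem eigIdem_orth (h : CubeRoots a b c) (hs : s ^ 3 = 1) : E a s * E b s = 0 := by
  rw [eigIdem_mul_eigIdem h.cube_b hs]
  have : 1 + a ^ 2 * b + a * b ^ 2 = 0 := by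
    grind [h.two, h.sum, h.prod_ab, h.prod_bc, h.prod_ca, h.cube_c]
  rw [this, zero_smul]

theorem eigIdem_decomp (h : CubeRoots a b c) (s x : R) :
    E a s * x + E b s * x + E c s * x = x := by
  rw [← add_mul, ← add_mul, eigIdem_add h, one_mul]

theorem mul_decomp (h : CubeRoots a b c) (hs : s ^ 3 = 1) (x : R) :
    s * x = a • (E a s * x) + b • (E b s * x) + c • (E c s * x) := by
  conv_lhs => rw [← eigIdem_decomp h s x]
  simp only [mul_add, ← mul_assoc, mul_eigIdem h.cube_a hs, mul_eigIdem h.cube_b hs,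
    mul_eigIdem h.cube_c hs, smul_mul_assoc]

theorem smul_of_eigIdem (h : CubeRoots a b c) (hs : s ^ 3 = 1) {x : R} (hx : E a s * x = x) :
    s * x = a • x := by
  rw [← hx, ← mul_assoc, mul_eigIdem h.cube_a hs, smul_mul_assoc]

/-- If two of the three components of `x` vanish, `x` is an eigenvector. -/
theorem eigIdem_eq_self (h : CubeRoots a b c) {x : R} (hb : E b s * x = 0)
    (hc : E c s * x = 0) : E a s * x = x := by
  have := eigIdem_decomp h s x
  rwa [hb, hc, add_zero, add_zero] at this

/-- Eliminating the a-component leaves the correction b - a = c on the b-component. This is the form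
in which the braid relation is expanded in `Ternary.nilpotent_apply`. -/
theorem mul_eq_of_eigIdem_eq_zero (h : CubeRoots a b c) (hs : s ^ 3 = 1) {x : R}
    (hc : E c s * x = 0) : s * x = a • x + c • (E b s * x) := by
  have h1 := eigIdem_decomp h s x
  have h2 := mul_decomp h hs x
  rw [hc, add_zero] at h1
  rw [hc, smul_zero, add_zero] at h2
  rw [h2]
  nth_rewrite 3 [← h1]
  match_scalars
  · ring
  · linear_combination h.sum - (a + c) * h.two

theorem commute_eigIdem (a b : k) (h : Commute s t) : Commute (E a s) (E b t) := by
  unfold eigIdem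
  have hl : ∀ u : R, Commute s u → Commute (1 + a ^ 2 • s + a • s ^ 2) u := fun u hu =>
    ((Commute.one_left u).add_left (hu.smul_left _)).add_left ((hu.pow_left 2).smul_left _)
  refine hl _ ?_
  exact ((Commute.one_right s).add_right (h.smul_right _)).add_right ((h.pow_right 2).smul_right _)

theorem commute_eigIdem_right (a : k) (h : Commute s t) : Commute s (E a t) := by
  unfold eigIdem
  exact ((Commute.one_right s).add_right (h.smul_right _)).add_right ((h.pow_right 2).smul_right _)

/-- Intertwiners of `s` and `t` intertwine their eigenprojections. -/
theorem intertwine_eigIdem (a : k) (h : r * s = t * r) : r * E a s = E a t * r := by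
  unfold eigIdem
  have h2 : r * s ^ 2 = t ^ 2 * r := by rw [pow_two, ← mul_assoc, h, mul_assoc, h, pow_two, mul_assoc]
  rw [mul_add, mul_add, add_mul, add_mul, mul_smul_comm, mul_smul_comm, smul_mul_assoc,
    smul_mul_assoc, h, h2, mul_one, one_mul]

theorem map_eigIdem {R' : Type*} [Ring R'] [Algebra k R'] (f : R →ₐ[k] R') (a : k) (s : R) :
    f (E a s) = E a (f s) := by
  simp [eigIdem]

/-- `s`, `t` are cubic braid generators with `E a s * E b t * E c s = 0` for distinct colours. -/
structure Ternary (k : Type*) {R : Type*} [CommRing k] [Ring R] [Algebra k R] (s t : R) :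
    Prop where
  cube_s : s ^ 3 = 1
  cube_t : t ^ 3 = 1
  braid : s * t * s = t * s * t
  orth : ∀ a b c : k, CubeRoots a b c → E a s * E b t * E c s = 0
  orth' : ∀ a b c : k, CubeRoots a b c → E a t * E b s * E c t = 0

theorem Ternary.symm (h : Ternary k s t) : Ternary k t s :=
  ⟨h.cube_t, h.cube_s, h.braid.symm, h.orth', h.orth⟩

theorem Ternary.orth_apply (h : Ternary k s t) (hc : CubeRoots a b c) (x : R) :
    E a s * (E b t * (E c s * x)) = 0 := by
  rw [← mul_assoc, ← mul_assoc, h.orth a b c hc, zero_mul]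

/-- The orthogonality relations leave each vector below with at most two components, so the braid
relation applied to z = E_b(t)x can be expanded in full. It says that an a-eigenvector of s and a
c-eigenvector of s add up to zero. -/
theorem Ternary.nilpotent_apply (h : Ternary k s t) (hc : CubeRoots a b c) (x : R) :
    E a s * (E b t * (E a s * (E b t * x))) = 0 := by
  set z := E b t * x with hz
  have tz : t * z = b • z := by rw [hz, ← mul_assoc, mul_eigIdem hc.cube_b h.cube_t, smul_mul_assoc]
  set u := E a s * z with hu
  set u' := E c s * z with hu'
  have su : s * u = a • u := by rw [hu, ← mul_assoc, mul_eigIdem hc.cube_a h.cube_s, smul_mul_assoc]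
  have su' : s * u' = c • u' := by
    rw [hu', ← mul_assoc, mul_eigIdem hc.cube_c h.cube_s, smul_mul_assoc]
  set g := E b t * u with hg
  set g' := E b t * u' with hg'
  have tu : t * u = a • u + c • g :=
    mul_eq_of_eigIdem_eq_zero hc h.cube_t (h.symm.orth_apply hc.rotate.rotate x)
  have tu' : t * u' = c • u' + a • g' :=
    mul_eq_of_eigIdem_eq_zero hc.swap.rotate.rotate h.cube_t
      (h.symm.orth_apply hc.swap.rotate x)
  set v := E a s * g with hv
  set v' := E c s * g' with hv'
  have sg : s * g = b • g + c • v :=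
    mul_eq_of_eigIdem_eq_zero hc.swap h.cube_s (h.orth_apply hc.swap.rotate.rotate z)
  have sg' : s * g' = b • g' + a • v' :=
    mul_eq_of_eigIdem_eq_zero hc.rotate h.cube_s (h.orth_apply hc z)
  have sz : s * z = b • z + c • u + a • u' := by
    have h1 := eigIdem_decomp hc s z
    rw [mul_decomp hc h.cube_s z, ← hu, ← hu']
    have h2 : E b s * z = z - u - u' := by
      rw [eq_sub_iff_add_eq, eq_sub_iff_add_eq]
      exact (by abel : E b s * z + u' + u = u + E b s * z + u').trans h1
    rw [h2]
    match_scalars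
    · linear_combination (-b - c) * hc.two + hc.sum
    · ring
    · linear_combination (-b - a) * hc.two + hc.sum
  have key : s * (t * (s * z)) = t * (s * (t * z)) := by
    simp only [← mul_assoc]
    rw [h.braid]
  -- In `key` the coefficients of v and v' are c³ = 1 and a³ = 1; all other terms cancel.
  have h1 : v + v' = 0 := by
    rw [tz, mul_smul_comm, mul_smul_comm, sz] at key
    simp only [mul_add, mul_smul_comm, tz, tu, tu', sz, su, su', sg, sg', smul_add, smul_smul]
      at key
    rw [← sub_eq_zero] at key
    rw [← key]
    match_scalars <;>
      grind [hc.two, hc.sum, hc.prod_ab, hc.prod_bc, hc.prod_ca, hc.cube_a, hc.cube_b, hc.cube_c]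
  have h2 : v = v' := hc.eq_of_add_eq_zero h1
  have sv : s * v = a • v := by rw [hv, ← mul_assoc, mul_eigIdem hc.cube_a h.cube_s, smul_mul_assoc]
  have sv' : s * v' = c • v' := by
    rw [hv', ← mul_assoc, mul_eigIdem hc.cube_c h.cube_s, smul_mul_assoc]
  rw [← h2] at sv'
  exact hc.swap.rotate.smul_cancel (sv.symm.trans sv')

end Eigen

/-! ### Vanishing products along chains of three and four generators -/

section Strands

variable {k R : Type*} [CommRing k] [Ring R] [Algebra k R] {a b c : k} {s t r q : R}

local notation "E" => eigIdem

theorem eigIdem_swap_apply (a b : k) (h : Commute s r) (x : R) :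
    E a s * (E b r * x) = E b r * (E a s * x) := by
  rw [← mul_assoc, (commute_eigIdem a b h).eq, mul_assoc]

theorem eigIdem_idem_apply (h : CubeRoots a b c) (hs : s ^ 3 = 1) (x : R) :
    E a s * (E a s * x) = E a s * x := by
  rw [← mul_assoc, eigIdem_idem h hs]

theorem eigIdem_orth_apply (h : CubeRoots a b c) (hs : s ^ 3 = 1) (x : R) :
    E a s * (E b s * x) = 0 := by
  rw [← mul_assoc, eigIdem_orth h hs, zero_mul]

/-- Insert the sum of the three projections of t, which is 1, between y and u. -/
theorem mul_eq_mul_component (h : CubeRoots a b c) {t u y : R} (ha : y * (E a t * u) = 0)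
    (hb : y * (E b t * u) = 0) : y * u = y * (E c t * u) := by
  conv_lhs => rw [← eigIdem_decomp h t u, mul_add, mul_add, ha, hb, add_zero, zero_add]

/-- Decompose E_a(s)x under t and apply E_b(s): the c-term vanishes by orthogonality and the total
is E_b(s)E_a(s)x = 0, so the other two terms agree in characteristic 2. -/
theorem Ternary.mid_eq (h : Ternary k s t) (hc : CubeRoots a b c) (x : R) :
    E b s * (E a t * (E a s * x)) = E b s * (E b t * (E a s * x)) := by
  refine hc.eq_of_add_eq_zero ?_
  have h1 := congrArg (E b s * ·) (eigIdem_decomp hc t (E a s * x))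
  simp only [mul_add] at h1
  rwa [h.orth_apply hc.rotate, add_zero, eigIdem_orth_apply hc.swap h.cube_s] at h1

/-- The braid relation gives a²b·x = ab²·x, and ab is a unit. -/
theorem eq_zero_of_smul_of_braid (h : s * t * s = t * s * t) (hc : CubeRoots a b c) {x : R}
    (hs : s * x = a • x) (ht : t * x = b • x) : x = 0 := by
  have h1 : s * (t * (s * x)) = t * (s * (t * x)) := by
    simp only [← mul_assoc]
    rw [h]
  simp only [hs, ht, mul_smul_comm, smul_smul] at h1
  refine hc.smul_cancel ?_
  have h2 := congrArg (c • ·) h1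
  simp only [smul_smul] at h2
  convert h2 using 2
  · linear_combination (-a * c) * hc.prod_ab - a * hc.cube_c
  · linear_combination (-b * c) * hc.prod_ab - b * hc.cube_c

/-- Along `s — t — r`, a vector with eigenvalues `a` and `c` at the ends has no component in the
middle which is a common eigenvector for the third eigenvalue. -/
theorem mid_component_eq_zero (hst : Ternary k s t) (hrt : Ternary k r t) (hsr : Commute s r)
    (hc : CubeRoots a b c) {v : R} (ha : E a s * v = v) (hv : E c r * v = v)
    (hs : E b s * (E b t * v) = E b t * v) (hr : E b r * (E b t * v) = E b t * v) :
    E b t * v = 0 := by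
  have h1 : E b s * (E a t * v) = E b t * v := by
    have := hst.mid_eq hc v
    rwa [ha, hs] at this
  have h2 : E b r * (E a t * v) = 0 := by
    have := hrt.orth_apply hc.swap v
    rwa [hv] at this
  -- E_b(t)v equals E_b(s)E_a(t)v by `mid_eq` at s, and E_b(r) kills this because it commutes with
  -- E_b(s) and kills E_a(t)v.
  rw [← hr, ← h1, eigIdem_swap_apply b b hsr.symm, h2, mul_zero]

/-- Let v be this vector. Nilpotency at (s, t) kills E_a(s)E_b(t)v and E_a(s)E_c(t)v, so v =
E_a(s)E_a(t)v. Nilpotency at (r, t) kills E_c(r)E_a(t)v, while v = E_c(r)v and the two ends commute.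
-/
theorem end_end_mid (hst : Ternary k s t) (hrt : Ternary k r t) (hsr : Commute s r)
    (hc : CubeRoots a b c) (x : R) : E a s * (E c r * (E b t * x)) = 0 := by
  set u := E c r * (E b t * x) with hu
  set w := E a s * (E b t * x) with hw
  set v := E a s * u with hv
  have hvw : v = E c r * w := eigIdem_swap_apply a c hsr _
  have hcab := hc.rotate.rotate
  have hacb := hc.swap.rotate
  have hav : E a s * v = v := eigIdem_idem_apply hc hst.cube_s _
  have hcv : E c r * v = v := by rw [hvw, eigIdem_idem_apply hcab hrt.cube_s]
  have hau : E a t * u = 0 := hrt.symm.orth_apply hacb x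
  have hcw : E c t * w = 0 := hst.symm.orth_apply hcab x
  have h1 : E a s * (E c t * v) = 0 := by
    have : E c t * v = E c t * (E a s * (E c t * u)) := by
      simp only [hv, ← mul_assoc (E c t)]
      refine mul_eq_mul_component hc ?_ ?_
      · rw [hau, mul_zero]
      · rw [mul_assoc, hst.symm.orth_apply hcab]
    rw [this, hst.nilpotent_apply hacb]
  have h2 : E a s * (E b t * v) = 0 := by
    have : E b t * v = E b t * (E a s * (E b t * u)) := by
      simp only [hv, ← mul_assoc (E b t)]
      refine mul_eq_mul_component hcab ?_ ?_
      · rw [mul_assoc, hst.symm.orth_apply hc.swap]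
      · rw [hau, mul_zero]
    rw [this, hst.nilpotent_apply hc]
  have h3 : E c r * (E a t * v) = 0 := by
    have : E a t * v = E a t * (E c r * (E a t * w)) := by
      rw [hvw]
      simp only [← mul_assoc (E a t)]
      refine mul_eq_mul_component hc.rotate ?_ ?_
      · rw [mul_assoc, hrt.symm.orth_apply hacb]
      · rw [hcw, mul_zero]
    rw [this, hrt.nilpotent_apply hcab]
  have h4 : v = E a s * (E a t * v) := by
    conv_lhs => rw [← hav]
    exact mul_eq_mul_component hc.rotate h2 h1
  rw [← hcv, h4, eigIdem_swap_apply c a hsr.symm, h3, mul_zero]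

/-- Decompose E_b(t)E_c(r)x under r. The a-part dies by orthogonality and the c-part by
`end_end_mid`; `mid_eq` turns the b-part into another instance of `end_end_mid`. -/
theorem end_mid_end (hst : Ternary k s t) (hrt : Ternary k r t) (hsr : Commute s r)
    (hc : CubeRoots a b c) (x : R) : E a s * (E b t * (E c r * x)) = 0 := by
  have h1 : E b r * (E b t * (E c r * x)) = E b r * (E c t * (E c r * x)) :=
    (hrt.mid_eq hc.swap.rotate.rotate x).symm
  rw [mul_eq_mul_component hc.swap.rotate (t := r), h1, end_end_mid hst hrt hsr hc.swap.rotate]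
  · rw [hrt.orth_apply hc, mul_zero]
  · rw [end_end_mid hst hrt hsr hc]

/-- Along s — t — r — q the vector turns out to have eigenvalue b at r as well. That rules out a and
c at t, so t acts as b while s acts as a, against the braid relation. -/
theorem adj_far (hst : Ternary k s t) (htr : Ternary k t r) (hrq : Ternary k r q)
    (hsr : Commute s r) (hsq : Commute s q) (htq : Commute t q) (hc : CubeRoots a b c) (x : R) :
    E a s * (E b t * (E c q * x)) = 0 := by
  set y := E a s * (E b t * (E c q * x)) with hy
  have h1 : y = E a s * (E b t * (E b r * (E c q * x))) := by
    rw [hy]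
    simp only [← mul_assoc (E a s)]
    refine mul_eq_mul_component hc.rotate.rotate ?_ ?_
    · rw [mul_assoc, end_mid_end hst htr.symm hsr hc]
    · rw [mul_assoc, end_mid_end htr hrq.symm htq hc.swap, mul_zero]
  have h2 : y = E a s * (E b r * (E c q * x)) := by
    rw [h1]
    refine (mul_eq_mul_component hc.rotate.rotate ?_ ?_).symm
    · rw [end_mid_end hst htr.symm hsr hc.swap.rotate]
    · rw [end_mid_end htr hrq.symm htq hc, mul_zero]
  have hs : E a s * y = y := eigIdem_idem_apply hc hst.cube_s _
  have hr : E b r * y = y := by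
    rw [h2, eigIdem_swap_apply a b hsr, eigIdem_idem_apply hc.rotate hrq.cube_s]
  have hq : E c q * y = y := by
    rw [hy, eigIdem_swap_apply b c htq, eigIdem_swap_apply a c hsq,
      eigIdem_idem_apply hc.rotate.rotate hrq.cube_t]
  have hat : E a t * y = 0 := by
    have := end_end_mid htr hrq.symm htq hc y
    rwa [hr, hq] at this
  have hct : E c t * y = 0 := hst.symm.orth_apply hc.rotate.rotate _
  exact eq_zero_of_smul_of_braid hst.braid hc (smul_of_eigIdem hc hst.cube_s hs)
    (smul_of_eigIdem hc.rotate hst.cube_t (eigIdem_eq_self hc.rotate hct hat))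

end Strands

/-! ### Vectors killed by the b-projections in a system of generators -/

/-- Neighbouring indices of the standard generators. -/
def Neighbours (i m : ℕ) : Prop := i + 1 = m ∨ m + 1 = i

/-- A sequence of cubic braid generators, of which the first `N` are considered, such that
neighbouring ones satisfy the relations of `Ternary`. -/
structure TernarySystem (k : Type*) {R : Type*} [CommRing k] [Ring R] [Algebra k R]
    (N : ℕ) (σ : ℕ → R) : Prop where
  cube : ∀ i < N, σ i ^ 3 = 1
  ternary : ∀ i m, Neighbours i m → i < N → m < N → Ternary k (σ i) (σ m)
  commute : ∀ i m, ¬ Neighbours i m → i < N → m < N → Commute (σ i) (σ m)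

section System

variable {k R : Type*} [CommRing k] [Ring R] [Algebra k R] {a b c : k} {s t r q : R}

local notation "E" => eigIdem

/-- The term `E b s * E a t * x`, for `x` killed by `E b s` and `E b t`. -/
theorem Ternary.socle (h : Ternary k s t) (hc : CubeRoots a b c) {x : R}
    (hs : E b s * x = 0) (ht : E b t * x = 0) :
    E b s * (E a t * x) = E b s * (E c t * x) ∧ E b t * (E b s * (E a t * x)) = E b s * (E a t * x) ∧
      E b s * (E a t * x) = E b t * (E a s * x) := by
  have key : ∀ {s t : R}, Ternary k s t → E b s * x = 0 → E b t * x = 0 →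
      E b s * (E a t * x) = E b s * (E c t * x) ∧
      E b t * (E b s * (E a t * x)) = E b s * (E a t * x) := by
    intro s t h hs ht
    have h1 : E b s * (E a t * x) = E b s * (E c t * x) := by
      refine hc.eq_of_add_eq_zero ?_
      have h2 := congrArg (E b s * ·) (eigIdem_decomp hc t x)
      simp only [mul_add, ht, add_zero, hs] at h2
      exact h2
    refine ⟨h1, eigIdem_eq_self hc.rotate ?_ ?_⟩
    · exact h.symm.orth_apply hc.swap.rotate.rotate x
    · rw [h1]
      exact h.symm.orth_apply hc x
  refine ⟨(key h hs ht).1, (key h hs ht).2, ?_⟩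
  -- The right-hand side is fixed by E_b(s); `mid_eq` then turns it into E_b(s)E_a(t)E_a(s)x, where
  -- E_a(s) may be dropped because the b- and c-components of x contribute nothing.
  have h3 := (key h.symm ht hs).2
  rw [← h3, ← h.mid_eq hc, ← mul_assoc, ← mul_assoc (E b s)]
  refine mul_eq_mul_component hc.rotate ?_ ?_
  · rw [hs, mul_zero]
  · rw [mul_assoc, h.orth_apply hc.swap]

/-- By `Ternary.socle` at either end, E_b(t)E_c(s)E_a(r)x is a b-eigenvector of both s and r, and
`mid_component_eq_zero` excludes such a vector. -/
theorem end_end_mid_eq_zero (hst : Ternary k s t) (hrt : Ternary k r t) (hsr : Commute s r)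
    (hc : CubeRoots a b c) {x : R} (hs : E b s * x = 0) (hr : E b r * x = 0)
    (hta : E b t * (E a r * x) = 0) (htc : E b t * (E c s * x) = 0) :
    E b t * (E a s * (E a r * x)) = 0 ∧ E b t * (E c s * (E a r * x)) = 0 := by
  have hs' : E b s * (E a r * x) = 0 := by rw [eigIdem_swap_apply b a hsr, hs, mul_zero]
  have hr' : E b r * (E c s * x) = 0 := by rw [eigIdem_swap_apply b c hsr.symm, hr, mul_zero]
  obtain ⟨h1, h2, -⟩ := hst.symm.socle hc hta hs'
  obtain ⟨-, h3, -⟩ := hrt.symm.socle hc htc hr'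
  rw [h1] at h2
  rw [eigIdem_swap_apply a c hsr.symm] at h3
  have h4 : E b t * (E c s * (E a r * x)) = 0 := by
    refine mid_component_eq_zero hrt hst hsr.symm hc ?_ ?_ h3 h2
    · rw [eigIdem_swap_apply c a hsr, eigIdem_idem_apply hc hrt.cube_s]
    · rw [eigIdem_idem_apply hc.rotate.rotate hst.cube_s]
  exact ⟨h1.trans h4, h4⟩

variable {N : ℕ} {σ : ℕ → R}

/-- The vectors which are killed by `E b (σ i)`, also after projecting with any `E d (σ m)`. -/
structure Killed (N : ℕ) (σ : ℕ → R) (a b c : k) (x : R) : Prop where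
  base : ∀ i < N, E b (σ i) * x = 0
  proj_a : ∀ i < N, ∀ m < N, E b (σ i) * (E a (σ m) * x) = 0
  proj_c : ∀ i < N, ∀ m < N, E b (σ i) * (E c (σ m) * x) = 0

theorem Killed.swap {x : R} (h : Killed N σ a b c x) : Killed N σ c b a x :=
  ⟨h.base, h.proj_c, h.proj_a⟩

/-- Conditions of depth one are enough to be stable: those of depth two follow from them, by the
relative positions of i, m and l. Only neighbouring i, m need an argument, since otherwise the two
projections commute. -/
theorem Killed.proj (hσ : TernarySystem k N σ) (hc : CubeRoots a b c) {x : R}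
    (h : Killed N σ a b c x) (l : ℕ) (hl : l < N) : Killed N σ a b c (E a (σ l) * x) := by
  -- The essential configuration: i is the middle of the chain m — i — l.
  have hcen : ∀ i < N, ∀ m < N, Neighbours i m → Neighbours i l → ¬ Neighbours m l →
      E b (σ i) * (E a (σ m) * (E a (σ l) * x)) = 0 ∧
      E b (σ i) * (E c (σ m) * (E a (σ l) * x)) = 0 := fun i hi m hm him hil hml =>
    end_end_mid_eq_zero (hσ.ternary i m him hi hm).symm (hσ.ternary i l hil hi hl).symm
      (hσ.commute m l hml hm hl) hc (h.base m hm) (h.base l hl) (h.proj_a i hi l hl)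
      (h.proj_c i hi m hm)
  have hall : ∀ i < N, ∀ m < N, E b (σ i) * (E a (σ m) * (E a (σ l) * x)) = 0 ∧
      E b (σ i) * (E c (σ m) * (E a (σ l) * x)) = 0 := by
    intro i hi m hm
    by_cases him : Neighbours i m
    swap
    · have hcomm := hσ.commute i m him hi hm
      rw [eigIdem_swap_apply b a hcomm, eigIdem_swap_apply b c hcomm, h.proj_a i hi l hl, mul_zero,
        mul_zero]
      exact ⟨rfl, rfl⟩
    by_cases hml : m = l
    · subst hml
      rw [eigIdem_idem_apply hc (hσ.cube m hm), eigIdem_orth_apply hc.rotate.rotate (hσ.cube m hm),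
        mul_zero]
      exact ⟨h.proj_a i hi m hm, rfl⟩
    by_cases hil : i = l
    · subst hil
      have ht := hσ.ternary i m him hi hm
      rw [ht.mid_eq hc, h.proj_a m hm i hi, mul_zero, ht.orth_apply hc.rotate]
      exact ⟨rfl, rfl⟩
    by_cases nil : Neighbours i l
    · refine hcen i hi m hm him nil ?_
      unfold Neighbours at *
      omega
    by_cases nml : Neighbours m l
    · have ht := hσ.ternary i m him hi hm
      -- Now m is the middle; `Ternary.socle` exchanges i and m and so reduces to `hcen`.
      have h1 := ht.socle hc (h.proj_a i hi l hl) (h.proj_a m hm l hl)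
      have h2 := (hcen m hm i hi him.symm nml nil).1
      rw [← h1.1, h1.2.2, h2]
      exact ⟨rfl, rfl⟩
    · have hcl := hσ.commute m l nml hm hl
      have hcl' := hσ.commute i l nil hi hl
      rw [eigIdem_swap_apply a a hcl, eigIdem_swap_apply c a hcl, eigIdem_swap_apply b a hcl',
        eigIdem_swap_apply b a hcl', h.proj_a i hi m hm, h.proj_c i hi m hm, mul_zero]
      exact ⟨rfl, rfl⟩
  exact ⟨fun i hi => h.proj_a i hi l hl, fun i hi m hm => (hall i hi m hm).1,
    fun i hi m hm => (hall i hi m hm).2⟩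

theorem Killed.add {x y : R} (hx : Killed N σ a b c x) (hy : Killed N σ a b c y) :
    Killed N σ a b c (x + y) :=
  ⟨fun i hi => by rw [mul_add, hx.base i hi, hy.base i hi, add_zero],
    fun i hi m hm => by rw [mul_add, mul_add, hx.proj_a i hi m hm, hy.proj_a i hi m hm, add_zero],
    fun i hi m hm => by rw [mul_add, mul_add, hx.proj_c i hi m hm, hy.proj_c i hi m hm, add_zero]⟩

theorem Killed.smul {x : R} (hx : Killed N σ a b c x) (d : k) : Killed N σ a b c (d • x) :=
  ⟨fun i hi => by rw [mul_smul_comm, hx.base i hi, smul_zero],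
    fun i hi m hm => by rw [mul_smul_comm, mul_smul_comm, hx.proj_a i hi m hm, smul_zero],
    fun i hi m hm => by rw [mul_smul_comm, mul_smul_comm, hx.proj_c i hi m hm, smul_zero]⟩

theorem Killed.mul_right {x : R} (hx : Killed N σ a b c x) (y : R) : Killed N σ a b c (x * y) :=
  ⟨fun i hi => by rw [← mul_assoc, hx.base i hi, zero_mul],
    fun i hi m hm => by
      rw [← mul_assoc (E a (σ m)), ← mul_assoc, hx.proj_a i hi m hm, zero_mul],
    fun i hi m hm => by
      rw [← mul_assoc (E c (σ m)), ← mul_assoc, hx.proj_c i hi m hm, zero_mul]⟩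

theorem Killed.mul_left (hσ : TernarySystem k N σ) (hc : CubeRoots a b c) {x : R}
    (h : Killed N σ a b c x) (l : ℕ) (hl : l < N) : Killed N σ a b c (σ l * x) := by
  rw [mul_decomp hc (hσ.cube l hl), h.base l hl, smul_zero, add_zero]
  exact ((h.proj hσ hc l hl).smul a).add ((h.swap.proj hσ hc.swap.rotate.rotate l hl).swap.smul c)

/-- The case l = 3 is `adj_far`. Further out, σ_l σ_{l+1} conjugates σ_l to σ_{l+1} and commutes
with σ_0 and σ_1. -/
theorem TernarySystem.far (hσ : TernarySystem k N σ) (hc : CubeRoots a b c) (l : ℕ) (hl : 3 ≤ l)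
    (hN : l < N) : ∀ x, E a (σ 0) * (E b (σ 1) * (E c (σ l) * x)) = 0 := by
  induction l, hl using Nat.le_induction with
  | base =>
    intro x
    refine adj_far (hσ.ternary 0 1 ?_ ?_ ?_) (hσ.ternary 1 2 ?_ ?_ ?_) (hσ.ternary 2 3 ?_ ?_ ?_)
      (hσ.commute 0 2 ?_ ?_ ?_) (hσ.commute 0 3 ?_ ?_ ?_) (hσ.commute 1 3 ?_ ?_ ?_) hc x <;>
      (try unfold Neighbours) <;> omega
  | succ l hl ih =>
    have ht := hσ.ternary l (l + 1) (Or.inl rfl) (by omega) hN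
    have hcomm : ∀ i < 2, Commute (σ i) (σ l * σ (l + 1)) := fun i hi =>
      (hσ.commute i l (by unfold Neighbours; omega) (by omega) (by omega)).mul_right
        (hσ.commute i (l + 1) (by unfold Neighbours; omega) (by omega) (by omega))
    have hint : σ l * σ (l + 1) * E c (σ l) = E c (σ (l + 1)) * (σ l * σ (l + 1)) :=
      intertwine_eigIdem c (by rw [ht.braid, mul_assoc])
    have hinv : (σ l * σ (l + 1)) * (σ (l + 1) ^ 2 * σ l ^ 2) = 1 := by
      have h1 := ht.cube_s
      have h2 := ht.cube_t
      calc _ = σ l * σ (l + 1) ^ 3 * σ l ^ 2 := by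
            simp only [pow_succ, pow_zero, one_mul, mul_assoc]
        _ = σ l ^ 3 := by rw [h2, mul_one, ← pow_succ']
        _ = 1 := h1
    intro x
    have h0 := (commute_eigIdem_right a (hcomm 0 (by omega)).symm).eq
    have h1 := (commute_eigIdem_right b (hcomm 1 (by omega)).symm).eq
    set w := σ l * σ (l + 1)
    rw [← one_mul x, ← hinv, mul_assoc w, ← mul_assoc _ w, ← hint, mul_assoc w, ← mul_assoc _ w,
      ← h1, mul_assoc w, ← mul_assoc _ w, ← h0, mul_assoc w, ih (by omega), mul_zero]

theorem TernarySystem.base_killed (hσ : TernarySystem k N σ) (hN : 2 ≤ N) (hc : CubeRoots a b c)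
    (l : ℕ) (hl : l < N) (x : R) : E b (σ l) * (E a (σ 0) * (E c (σ 1) * x)) = 0 := by
  have h01 := hσ.ternary 0 1 (Or.inl rfl) (by omega) (by omega)
  rcases (by omega : l = 0 ∨ l = 1 ∨ l = 2 ∨ 3 ≤ l) with rfl | rfl | rfl | h3
  · exact eigIdem_orth_apply hc.swap h01.cube_s _
  · exact h01.symm.orth_apply hc.swap x
  · exact end_end_mid (hσ.ternary 2 1 (Or.inr rfl) hl (by omega)) h01
      (hσ.commute 2 0 (by unfold Neighbours; omega) hl (by omega)) hc.rotate x
  · rw [eigIdem_swap_apply b a (hσ.commute l 0 (by unfold Neighbours; omega) hl (by omega)),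
      eigIdem_swap_apply b c (hσ.commute l 1 (by unfold Neighbours; omega) hl (by omega))]
    exact hσ.far hc.swap.rotate l h3 hl x

/-- This starts the induction over the ideal of products. `Ternary.socle` makes the depth-one terms
symmetric in i and m and in the colours a and c, so only a few positions near the start of the chain
remain. -/
theorem TernarySystem.killed (hσ : TernarySystem k N σ) (hN : 2 ≤ N) (hc : CubeRoots a b c)
    (x : R) : Killed N σ a b c (E a (σ 0) * (E c (σ 1) * x)) := by
  have hb := hσ.base_killed hN hc
  have h01 := hσ.ternary 0 1 (Or.inl rfl) (by omega) (by omega)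
  have h1 : ∀ x, E b (σ 1) * (E a (σ 0) * (E a (σ 0) * (E c (σ 1) * x))) = 0 := fun x => by
    rw [eigIdem_idem_apply hc h01.cube_s]
    exact hb 1 (by omega) x
  -- On the chain 0 — 1 — 2 the vector would be a common b-eigenvector of both ends, which
  -- `mid_component_eq_zero` forbids.
  have h2 : ∀ h : 2 < N, ∀ x, E b (σ 1) * (E a (σ 2) * (E a (σ 0) * (E c (σ 1) * x))) = 0 := by
    intro h2 x
    have h21 := hσ.ternary 2 1 (Or.inr rfl) h2 (by omega)
    have h02 := hσ.commute 0 2 (by unfold Neighbours; omega) (by omega) h2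
    obtain ⟨e1, e2, -⟩ := h21.symm.socle hc (hb 1 (by omega) x) (hb 2 h2 x)
    have e3 := (h01.symm.socle hc (x := E a (σ 2) * (E c (σ 1) * x))
      (h21.symm.orth_apply hc.swap x)
      (end_end_mid h01 h21 h02 hc.rotate x)).2.1
    rw [eigIdem_swap_apply a a h02] at e3
    rw [e1] at e2 e3 ⊢
    refine mid_component_eq_zero h01 h21 h02 hc ?_ ?_ e3 e2
    · rw [eigIdem_swap_apply c a h02.symm, eigIdem_idem_apply hc h01.cube_s]
    · rw [eigIdem_idem_apply hc.rotate.rotate h21.cube_s]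
  have hfar : ∀ i < N, ∀ m < N, 3 ≤ m →
      E b (σ i) * (E a (σ m) * (E a (σ 0) * (E c (σ 1) * x))) = 0 := by
    intro i hi m hm h3
    rw [eigIdem_swap_apply a a (hσ.commute m 0 (by unfold Neighbours; omega) hm (by omega)),
      eigIdem_swap_apply a c (hσ.commute m 1 (by unfold Neighbours; omega) hm (by omega))]
    exact hb i hi _
  have hsoc : ∀ i < N, ∀ m < N, Neighbours i m → _ := fun i hi m hm him =>
    (hσ.ternary i m him hi hm).socle hc (hb i hi x) (hb m hm x)
  have hadj : ∀ i < N, ∀ m < N, Neighbours i m →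
      E b (σ i) * (E a (σ m) * (E a (σ 0) * (E c (σ 1) * x))) = 0 := by
    intro i hi m hm him
    have hsym := (hsoc i hi m hm him).2.2
    rcases (by unfold Neighbours at him; omega : 3 ≤ m ∨ 3 ≤ i ∨ i = 1 ∧ m = 2 ∨ i = 2 ∧ m = 1 ∨
      i = 0 ∧ m = 1 ∨ i = 1 ∧ m = 0) with h | h | ⟨rfl, rfl⟩ | ⟨rfl, rfl⟩ | ⟨rfl, rfl⟩ | ⟨rfl, rfl⟩
    · exact hfar i hi m hm h
    · rw [hsym]
      exact hfar m hm i hi h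
    · exact h2 hm x
    · rw [hsym]
      exact h2 hi x
    · rw [hsym]
      exact h1 x
    · exact h1 x
  refine ⟨fun l hl => hb l hl x, fun i hi m hm => ?_, fun i hi m hm => ?_⟩
  · by_cases him : Neighbours i m
    · exact hadj i hi m hm him
    · rw [eigIdem_swap_apply b a (hσ.commute i m him hi hm), hb i hi, mul_zero]
  · by_cases him : Neighbours i m
    · rw [← (hsoc i hi m hm him).1]
      exact hadj i hi m hm him
    · rw [eigIdem_swap_apply b c (hσ.commute i m him hi hm), hb i hi, mul_zero]

end System

/-! ### Conjugacy of neighbouring pairs, and merging two eigenvalues -/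

/-- The first `N` terms of `σ` satisfy the cubic and the braid relations. -/
structure CubicBraid {R : Type*} [Ring R] (N : ℕ) (σ : ℕ → R) : Prop where
  cube : ∀ i < N, σ i ^ 3 = 1
  braid : ∀ i m, Neighbours i m → i < N → m < N → σ i * σ m * σ i = σ m * σ i * σ m
  commute : ∀ i m, ¬ Neighbours i m → i < N → m < N → Commute (σ i) (σ m)

section Split

variable {k R : Type*} [CommRing k] [Ring R] [Algebra k R] {a b c : k} {s t : R} {N : ℕ}
  {σ : ℕ → R}

local notation "E" => eigIdem

theorem CubicBraid.map {R' : Type*} [Ring R'] (h : CubicBraid N σ) (f : R →+* R') :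
    CubicBraid N (fun i => f (σ i)) :=
  ⟨fun i hi => by rw [← map_pow, h.cube i hi, map_one],
    fun i m him hi hm => by simp only [← map_mul, h.braid i m him hi hm],
    fun i m him hi hm => (h.commute i m him hi hm).map f⟩

theorem CubicBraid.isUnit (h : CubicBraid N σ) {i : ℕ} (hi : i < N) : IsUnit (σ i) :=
  IsUnit.of_pow_eq_one (h.cube i hi) (by norm_num)

/-- All pairs of neighbouring generators are conjugate to the first one. -/
theorem CubicBraid.exists_conj (h : CubicBraid N σ) {i m : ℕ} (him : Neighbours i m) (hi : i < N)
    (hm : m < N) : ∃ w : R, IsUnit w ∧ w * σ 0 = σ i * w ∧ w * σ 1 = σ m * w := by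
  have up : ∀ i, i + 1 < N → ∃ w : R, IsUnit w ∧ w * σ 0 = σ i * w ∧ w * σ 1 = σ (i + 1) * w := by
    intro i
    induction i with
    | zero => exact fun _ => ⟨1, isUnit_one, by simp, by simp⟩
    | succ i ih =>
      intro hi
      obtain ⟨w, hw, h0, h1⟩ := ih (by omega)
      have b1 := h.braid i (i + 1) (Or.inl rfl) (by omega) (by omega)
      have b2 := h.braid (i + 1) (i + 1 + 1) (Or.inl rfl) (by omega) (by omega)
      have c1 := (h.commute i (i + 1 + 1) (by unfold Neighbours; omega) (by omega) (by omega)).eq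
      -- Conjugation by σ_i σ_{i+1} σ_{i+2} shifts the pair (σ_i, σ_{i+1}) up by one.
      refine ⟨σ i * σ (i + 1) * σ (i + 1 + 1) * w, (((h.isUnit (by omega)).mul
        (h.isUnit (by omega))).mul (h.isUnit (by omega))).mul hw, ?_, ?_⟩
      · rw [mul_assoc, h0, ← mul_assoc, mul_assoc (σ i * σ (i + 1)), ← c1, ← mul_assoc, b1]
        simp only [mul_assoc]
      · rw [mul_assoc, h1, ← mul_assoc, mul_assoc (σ i), mul_assoc (σ i), b2, ← mul_assoc,
          ← mul_assoc, c1]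
        simp only [mul_assoc]
  rcases him with rfl | rfl
  · exact up i hm
  · obtain ⟨w, hw, h0, h1⟩ := up m hi
    have b1 := h.braid m (m + 1) (Or.inl rfl) hm hi
    -- The half twist on three strands exchanges σ_m and σ_{m+1}.
    refine ⟨σ m * σ (m + 1) * σ m * w, (((h.isUnit hm).mul (h.isUnit hi)).mul
      (h.isUnit hm)).mul hw, ?_, ?_⟩
    · have e : σ m * σ (m + 1) * σ m * σ m = σ (m + 1) * (σ m * σ (m + 1) * σ m) := by
        conv_lhs => rw [b1]
        simp only [mul_assoc]
      rw [mul_assoc, h0, ← mul_assoc, e, mul_assoc]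
    · have e : σ m * σ (m + 1) * σ m * σ (m + 1) = σ m * (σ m * σ (m + 1) * σ m) := by
        conv_rhs => rw [b1]
        simp only [mul_assoc]
      rw [mul_assoc, h1, ← mul_assoc, e, mul_assoc]

theorem eigIdem_mul_conj (a c : k) {w s t s' t' : R} (hs : w * s = s' * w) (ht : w * t = t' * w) :
    w * (E a s * E c t) = E a s' * E c t' * w := by
  rw [← mul_assoc, intertwine_eigIdem a hs, mul_assoc, intertwine_eigIdem c ht, mul_assoc]

/-- Neighbours follow by conjugation. For larger distance, induction shows that the next generator i
+ 1 has neither eigenvalue a nor c on the product, hence acts as b; but σ_i acts as a, so the braid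
relation makes the product zero. -/
theorem CubicBraid.eigIdem_mul_eq_zero (h : CubicBraid N σ) (hc : CubeRoots a b c)
    (h1 : E a (σ 0) * E c (σ 1) = 0) (h2 : E c (σ 0) * E a (σ 1) = 0) (i m : ℕ) (hi : i < N)
    (hm : m < N) (him : i ≠ m) : E a (σ i) * E c (σ m) = 0 := by
  have hadj : ∀ {a c : k}, E a (σ 0) * E c (σ 1) = 0 → ∀ i m, Neighbours i m → i < N → m < N →
      E a (σ i) * E c (σ m) = 0 := by
    intro a c h1 i m him hi hm
    obtain ⟨w, hw, e0, e1⟩ := h.exists_conj him hi hm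
    have := eigIdem_mul_conj a c e0 e1
    rwa [h1, mul_zero, eq_comm, hw.mul_left_eq_zero] at this
  have hlt : ∀ d : ℕ, ∀ {a b c : k}, CubeRoots a b c → E a (σ 0) * E c (σ 1) = 0 →
      E c (σ 0) * E a (σ 1) = 0 → ∀ i, i + d + 1 < N → E a (σ i) * E c (σ (i + d + 1)) = 0 := by
    intro d
    induction d with
    | zero => exact fun _ h1 _ i hi => hadj h1 i (i + 1) (Or.inl rfl) (by omega) hi
    | succ d ih =>
      intro a b c hc h1 h2 i hi
      have hcomm := h.commute i (i + (d + 1) + 1) (by unfold Neighbours; omega) (by omega) hi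
      set v := E a (σ i) * E c (σ (i + (d + 1) + 1)) with hv
      have hcv : E c (σ (i + 1)) * v = 0 := by
        rw [hv, ← mul_assoc, hadj h2 (i + 1) i (Or.inr rfl) (by omega) (by omega), zero_mul]
      have hav : E a (σ (i + 1)) * v = 0 := by
        have := ih hc h1 h2 (i + 1) (by omega)
        rw [hv, (commute_eigIdem a c hcomm).eq, ← mul_assoc,
          show i + (d + 1) + 1 = i + 1 + d + 1 by ring, this, zero_mul]
      have hbv : σ (i + 1) * v = b • v := by
        refine smul_of_eigIdem hc.rotate (h.cube _ (by omega)) ?_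
        exact eigIdem_eq_self hc.rotate hcv hav
      have hsv : σ i * v = a • v := by
        rw [hv, ← mul_assoc, mul_eigIdem hc.cube_a (h.cube _ (by omega)), smul_mul_assoc]
      exact eq_zero_of_smul_of_braid (h.braid i (i + 1) (Or.inl rfl) (by omega) (by omega)) hc
        hsv hbv
  by_cases hadj' : Neighbours i m
  · exact hadj h1 i m hadj' hi hm
  rcases lt_or_gt_of_ne him with hl | hl
  · have := hlt (m - i - 1) hc h1 h2 i (by omega)
    rwa [show i + (m - i - 1) + 1 = m by omega] at this
  · have := hlt (i - m - 1) hc.swap.rotate.rotate h2 h1 m (by omega)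
    rw [show m + (i - m - 1) + 1 = i by omega] at this
    rwa [(commute_eigIdem a c (h.commute i m hadj' hi hm)).eq]

/-- The element with eigenvalue `a` where `s` has eigenvalue `a`, and `b` elsewhere; here `a`, `b`,
`c` are the three cube roots of unity. -/
def merge (a b c : k) (s : R) : R := b • 1 + c • E a s

theorem merge_cube (hc : CubeRoots a b c) (hs : s ^ 3 = 1) : merge a b c s ^ 3 = 1 := by
  have h1 := eigIdem_idem hc hs
  rw [merge, pow_succ, pow_two]
  simp only [mul_add, add_mul, smul_mul_assoc, mul_smul_comm, h1, mul_one, one_mul]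
  match_scalars
  · linear_combination hc.cube_b
  · grind [hc.two, hc.sum, hc.prod_ab, hc.prod_bc, hc.prod_ca, hc.cube_a, hc.cube_b, hc.cube_c]

theorem eigIdem_merge (hc : CubeRoots a b c) (hs : s ^ 3 = 1) :
    E a (merge a b c s) = E a s := by
  have h1 := eigIdem_idem hc hs
  have h2 : E a (merge a b c s) = 1 + a ^ 2 • (b • 1 + c • E a s) +
    a • ((b • 1 + c • E a s) * (b • 1 + c • E a s)) := by rw [← pow_two]; rfl
  rw [h2]
  simp only [mul_add, add_mul, smul_mul_assoc, mul_smul_comm, h1, mul_one, one_mul]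
  match_scalars <;>
    grind [hc.two, hc.sum, hc.prod_ab, hc.prod_bc, hc.prod_ca, hc.cube_a, hc.cube_b, hc.cube_c]

theorem merge_quadratic (hc : CubeRoots a b c) (hs : s ^ 3 = 1) :
    (merge a b c s - algebraMap k R a) * (merge a b c s - algebraMap k R b) = 0 := by
  have h1 := eigIdem_idem hc hs
  rw [merge, Algebra.algebraMap_eq_smul_one, Algebra.algebraMap_eq_smul_one]
  simp only [mul_add, add_mul, mul_sub, sub_mul, smul_mul_assoc, mul_smul_comm, h1, mul_one,
    one_mul]
  match_scalars <;>
    grind [hc.two, hc.sum, hc.prod_ab, hc.prod_bc, hc.prod_ca, hc.cube_a, hc.cube_b, hc.cube_c]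

/-- Merging alters s only on its c-part, where c is replaced by b, and c - b = a. -/
theorem merge_add (hc : CubeRoots a b c) (hs : s ^ 3 = 1) : s = merge a b c s + a • E c s := by
  have h1 := mul_decomp hc hs 1
  have h2 := eigIdem_add hc s
  simp only [mul_one] at h1
  conv_lhs => rw [h1]
  rw [merge, ← h2]
  match_scalars
  · linear_combination hc.sum - (b + c) * hc.two
  · ring
  · linear_combination hc.sum - (b + a) * hc.two

theorem braid_expand (hc : CubeRoots a b c) {e f : R} (he : e * e = e) (hf : f * f = f) :
    (b • 1 + c • e) * (b • 1 + c • f) * (b • 1 + c • e) =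
      (b • 1 + c • f) * (b • 1 + c • e) * (b • 1 + c • f) + (e + f + e * f * e + f * e * f) := by
  simp only [mul_add, add_mul, smul_mul_assoc, mul_smul_comm, he, hf, mul_one, one_mul]
  match_scalars <;>
    grind [hc.two, hc.sum, hc.prod_ab, hc.prod_bc, hc.prod_ca, hc.cube_a, hc.cube_b, hc.cube_c]

/-- With B(e, f) = e + f + efe + fef, the braid relation for s, t reads B(e, f) + B(e', f') = 0,
since mixed products vanish; what is needed is B(e, f) = 0 alone (`braid_expand`). -/
theorem merge_braid (hc : CubeRoots a b c) (hs : s ^ 3 = 1) (ht : t ^ 3 = 1)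
    (hst : s * t * s = t * s * t) (h1 : E a s * E c t = 0) (h2 : E c s * E a t = 0)
    (h3 : E a t * E c s = 0) (h4 : E c t * E a s = 0) :
    merge a b c s * merge a b c t * merge a b c s =
      merge a b c t * merge a b c s * merge a b c t := by
  set e := E a s with he
  set f := E a t with hf
  set e' := E c s with he'
  set f' := E c t with hf'
  have hee : e * e = e := eigIdem_idem hc hs
  have hff : f * f = f := eigIdem_idem hc ht
  have hee' : e' * e' = e' := eigIdem_idem hc.rotate.rotate hs
  have hff' : f' * f' = f' := eigIdem_idem hc.rotate.rotate ht
  have o1 : e * e' = 0 := eigIdem_orth hc.swap.rotate hs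
  have o2 : e' * e = 0 := eigIdem_orth hc.rotate.rotate hs
  have o3 : f * f' = 0 := eigIdem_orth hc.swap.rotate ht
  have o4 : f' * f = 0 := eigIdem_orth hc.rotate.rotate ht
  have S : s = b • 1 + c • e + a • e' := merge_add hc hs
  have T : t = b • 1 + c • f + a • f' := merge_add hc ht
  have hsum : (e + f + e * f * e + f * e * f) + (e' + f' + e' * f' * e' + f' * e' * f') = 0 := by
    have hst' := sub_eq_zero.2 hst
    rw [S, T] at hst'
    rw [← hst']
    simp only [mul_add, add_mul, smul_mul_assoc, mul_smul_comm, hee, hff, hee', hff', o1, o2, o3,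
      o4, h1, h2, h3, h4, mul_one, one_mul, mul_zero, smul_zero, add_zero,
      mul_assoc]
    match_scalars <;>
      grind [hc.two, hc.sum, hc.prod_ab, hc.prod_bc, hc.prod_ca, hc.cube_a, hc.cube_b, hc.cube_c]
  -- Left multiplication by f and right multiplication by e both kill the primed half; the sum of
  -- the two results is B(e, f) up to terms occurring twice.
  have r1 := congrArg (f * ·) hsum
  have r2 := congrArg (· * e) hsum
  have hR : e + f + e * f * e + f * e * f = 0 := by
    simp only [mul_add, add_mul, hee, hff, mul_zero, zero_mul] at r1 r2
    simp only [mul_assoc, o2, h4, mul_zero, add_zero, hee] at r2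
    simp only [← mul_assoc, o3, h3, hff, zero_mul, add_zero] at r1
    have : e + f + e * f * e + f * e * f = (f * e + f + f * e * f * e + f * e * f) +
        (e + f * e + e * f * e + f * e * f * e) - 2 • (f * e) - 2 • (f * e * f * e) := by abel
    rw [this, r1]
    simp only [← mul_assoc] at r2
    rw [r2, two_smul, two_smul, hc.add_self (f * e), hc.add_self (f * e * f * e), add_zero, sub_zero,
      sub_zero]
  have := braid_expand hc hee hff
  rwa [hR, add_zero] at this

end Split

/-! ### Generators of the group algebra and its universal property -/

section GroupAlgebra

local notation "E" => eigIdem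

/-- The generator `s_{i+1}` in the group algebra (and `1` if `i` is out of range). -/
noncomputable def algGen (k : Type*) [CommRing k] (n i : ℕ) : MonoidAlgebra k (Γ n) :=
  if h : i < n - 1 then toAlg k (gen n ⟨i, h⟩) else 1

variable {k R : Type*} [CommRing k] [Ring R] [Algebra k R] {n : ℕ}

theorem toAlg_mul (g h : Γ n) : toAlg k (g * h) = toAlg k g * toAlg k h := map_mul _ _ _

theorem toAlg_one : toAlg k (1 : Γ n) = 1 := map_one _

theorem toAlg_pow (g : Γ n) (m : ℕ) : toAlg k (g ^ m) = toAlg k g ^ m := map_pow _ _ _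

theorem algGen_eq (i : Fin (n - 1)) : algGen k n i = toAlg k (gen n i) := by
  simp [algGen, i.2]

theorem gen_cube (i : Fin (n - 1)) : gen n i ^ 3 = 1 :=
  PresentedGroup.one_of_mem (rels := {r | Rel n r}) (Rel.cube i)

theorem gen_braid (i m : Fin (n - 1)) (h : (i : ℕ) + 1 = m) :
    gen n i * gen n m * gen n i = gen n m * gen n i * gen n m :=
  mul_inv_eq_one.1 (PresentedGroup.one_of_mem (rels := {r | Rel n r}) (Rel.braid i m h))

theorem gen_comm (i m : Fin (n - 1)) (h : (i : ℕ) + 1 < m) :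
    gen n i * gen n m = gen n m * gen n i :=
  mul_inv_eq_one.1 (PresentedGroup.one_of_mem (rels := {r | Rel n r}) (Rel.comm i m h))

theorem cubicBraid_algGen (k : Type*) [CommRing k] (n : ℕ) :
    CubicBraid (n - 1) (algGen k n) := by
  refine ⟨fun i hi => ?_, fun i m him hi hm => ?_, fun i m him hi hm => ?_⟩
  · rw [algGen_eq ⟨i, hi⟩, ← map_pow, gen_cube, map_one]
  · rw [algGen_eq ⟨i, hi⟩, algGen_eq ⟨m, hm⟩]
    simp only [← map_mul]
    congr 1
    rcases him with h | h
    · exact gen_braid _ _ h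
    · exact (gen_braid _ _ h).symm
  · rw [algGen_eq ⟨i, hi⟩, algGen_eq ⟨m, hm⟩, commute_iff_eq, ← map_mul, ← map_mul]
    congr 1
    rcases lt_trichotomy i m with h | rfl | h
    · exact gen_comm _ _ (by unfold Neighbours at him; simp only; omega)
    · rfl
    · exact (gen_comm _ _ (by unfold Neighbours at him; simp only; omega)).symm

/-- The group algebra is the universal algebra with cubic braid generators. -/
theorem exists_algHom {σ : ℕ → R} (h : CubicBraid (n - 1) σ) :
    ∃ φ : MonoidAlgebra k (Γ n) →ₐ[k] R, ∀ i < n - 1, φ (algGen k n i) = σ i := by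
  have hrel : ∀ r ∈ {r | Rel n r},
      FreeGroup.lift (fun i : Fin (n - 1) => Units.ofPowEqOne (σ i) 3 (h.cube i i.2) (by norm_num))
        r = 1 := by
    rintro _ (⟨i, m, him⟩ | ⟨i, m, him⟩ | i)
    · rw [map_mul, map_inv, mul_inv_eq_one]
      ext
      simpa using (h.commute i m (by unfold Neighbours; omega) i.2 m.2).eq
    · rw [map_mul, map_inv, mul_inv_eq_one]
      ext
      simpa using h.braid i m (Or.inl him) i.2 m.2
    · ext
      simp
  refine ⟨MonoidAlgebra.lift k R (Γ n) ((Units.coeHom R).comp (PresentedGroup.toGroup hrel)),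
    fun i hi => ?_⟩
  rw [algGen_eq ⟨i, hi⟩]
  simp

theorem adjoin_algGen (k : Type*) [CommRing k] (n : ℕ) :
    Algebra.adjoin k (algGen k n '' {i | i < n - 1}) = ⊤ := by
  set S := Algebra.adjoin k (algGen k n '' {i | i < n - 1}) with hS
  have hgen : ∀ i : Fin (n - 1), toAlg k (gen n i) ∈ S := fun i => by
    rw [← algGen_eq]
    exact Algebra.subset_adjoin ⟨i, i.2, rfl⟩
  have hg : ∀ g : Γ n, toAlg k g ∈ S := by
    intro g
    have hmem : g ∈ (Subgroup.closure (Set.range (PresentedGroup.of (rels := {r | Rel n r})))) := by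
      rw [PresentedGroup.closure_range_of]
      trivial
    rw [← Subgroup.mem_toSubmonoid, Subgroup.closure_toSubmonoid] at hmem
    induction hmem using Submonoid.closure_induction with
    | mem x hx =>
      rcases hx with ⟨i, rfl⟩ | hx
      · exact hgen i
      · obtain ⟨i, hi⟩ := hx
        -- An inverse generator is a square, so no inverses are needed to generate the algebra.
        have : x = gen n i ^ 2 := by
          rw [← inv_inv x, ← hi, inv_eq_iff_mul_eq_one, ← pow_succ']
          exact gen_cube i
        rw [this, toAlg_pow]
        exact pow_mem (hgen i) 2
    | one => rw [toAlg_one]; exact one_mem S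
    | mul x y _ _ hx hy => rw [toAlg_mul]; exact mul_mem hx hy
  rw [eq_top_iff]
  rintro x -
  induction x using MonoidAlgebra.induction_on with
  | of g => exact hg g
  | add x y hx hy => exact add_mem hx hy
  | smul r x hx => exact S.smul_mem hx r

theorem mul_left_induction {p : R → Prop} (φ : MonoidAlgebra k (Γ n) →ₐ[k] R)
    (hadd : ∀ x y, p x → p y → p (x + y)) (hsmul : ∀ (d : k) x, p x → p (d • x))
    (hmul : ∀ i < n - 1, ∀ x, p x → p (φ (algGen k n i) * x)) (y : MonoidAlgebra k (Γ n)) {x : R}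
    (hx : p x) : p (φ y * x) := by
  have hy : y ∈ Algebra.adjoin k (algGen k n '' {i | i < n - 1}) := by
    rw [adjoin_algGen]
    trivial
  induction hy using Algebra.adjoin_induction generalizing x with
  | mem y hy =>
    obtain ⟨i, hi, rfl⟩ := hy
    exact hmul i hi x hx
  | algebraMap d =>
    rw [AlgHom.commutes, ← Algebra.smul_def]
    exact hsmul d x hx
  | add y z _ _ hy hz =>
    rw [map_add, add_mul]
    exact hadd _ _ (hy hx) (hz hx)
  | mul y z _ _ hy hz =>
    rw [map_mul, mul_assoc]
    exact hy (hz hx)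

theorem mul_right_induction {p : R → Prop} (φ : MonoidAlgebra k (Γ n) →ₐ[k] R)
    (hadd : ∀ x y, p x → p y → p (x + y)) (hsmul : ∀ (d : k) x, p x → p (d • x))
    (hmul : ∀ i < n - 1, ∀ x, p x → p (x * φ (algGen k n i))) (y : MonoidAlgebra k (Γ n)) {x : R}
    (hx : p x) : p (x * φ y) := by
  have hy : y ∈ Algebra.adjoin k (algGen k n '' {i | i < n - 1}) := by
    rw [adjoin_algGen]
    trivial
  induction hy using Algebra.adjoin_induction generalizing x with
  | mem y hy =>
    obtain ⟨i, hi, rfl⟩ := hy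
    exact hmul i hi x hx
  | algebraMap d =>
    rw [AlgHom.commutes, ← Algebra.commutes, ← Algebra.smul_def]
    exact hsmul d x hx
  | add y z _ _ hy hz =>
    rw [map_add, mul_add]
    exact hadd _ _ (hy hx) (hz hx)
  | mul y z _ _ hy hz =>
    rw [map_mul, ← mul_assoc]
    exact hz (hy hx)

end GroupAlgebra

/-! ### Hecke ideals, their intersections, and the ideal generated by **b** -/

section Ideals

local notation "E" => eigIdem

variable {k : Type*} [CommRing k] {n : ℕ} {a b c : k}

theorem quotMk_eq_zero_iff {A : Type*} [Ring A] [Algebra k A] (I : TwoSidedIdeal A) {x : A} :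
    quotMk k I x = 0 ↔ x ∈ I :=
  ⟨fun h => (I.mem_iff x).2 ((RingCon.eq I.ringCon).1 h), quotMk_eq_zero I⟩

theorem smul_mem_twoSidedIdeal {A : Type*} [Ring A] [Algebra k A] (I : TwoSidedIdeal A) (d : k)
    {x : A} (hx : x ∈ I) : d • x ∈ I := by
  rw [Algebra.smul_def]
  exact I.mul_mem_left _ _ hx

theorem toAlg_s₁ (hn : 3 ≤ n) : toAlg k (s₁ hn) = algGen k n 0 :=
  (algGen_eq ⟨0, by omega⟩).symm

theorem toAlg_s₂ (hn : 3 ≤ n) : toAlg k (s₂ hn) = algGen k n 1 :=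
  (algGen_eq ⟨1, by omega⟩).symm

theorem gen_inv (i : Fin (n - 1)) : (gen n i)⁻¹ = gen n i ^ 2 := by
  rw [inv_eq_iff_mul_eq_one, ← pow_succ']
  exact gen_cube i

theorem b_eq (hn : 3 ≤ n) : TernaryHecke.b k hn = algGen k n 0 * algGen k n 1 ^ 2 +
    algGen k n 1 ^ 2 * algGen k n 0 + algGen k n 0 ^ 2 * algGen k n 1 +
      algGen k n 1 * algGen k n 0 ^ 2 := by
  have h1 : toAlg k ((s₁ hn)⁻¹) = algGen k n 0 ^ 2 := by
    rw [gen_inv, toAlg_pow]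
    exact congrArg (· ^ 2) (toAlg_s₁ hn)
  have h2 : toAlg k ((s₂ hn)⁻¹) = algGen k n 1 ^ 2 := by
    rw [gen_inv, toAlg_pow]
    exact congrArg (· ^ 2) (toAlg_s₂ hn)
  simp only [TernaryHecke.b, toAlg_mul, h1, h2, toAlg_s₁, toAlg_s₂]

theorem heckeIdeal_eq_span (hn : 3 ≤ n) (hc : CubeRoots a b c) :
    heckeIdeal hn a b = TwoSidedIdeal.span {E c (algGen k n 0)} := by
  have h : (toAlg k (s₁ hn) - algebraMap k _ a) * (toAlg k (s₁ hn) - algebraMap k _ b) =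
      c ^ 2 • E c (algGen k n 0) := by
    rw [toAlg_s₁, eigIdem, Algebra.algebraMap_eq_smul_one, Algebra.algebraMap_eq_smul_one,
      pow_two (algGen k n 0)]
    simp only [mul_sub, sub_mul, smul_mul_assoc, mul_smul_comm, mul_one, one_mul]
    match_scalars <;>
      grind [hc.two, hc.sum, hc.prod_ab, hc.prod_bc, hc.prod_ca, hc.cube_a, hc.cube_b, hc.cube_c]
  rw [heckeIdeal, h]
  apply le_antisymm
  · rw [TwoSidedIdeal.span_le]
    rintro _ rfl
    exact smul_mem_twoSidedIdeal _ _ (TwoSidedIdeal.subset_span rfl)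
  · rw [TwoSidedIdeal.span_le]
    rintro _ rfl
    have h1 := smul_mem_twoSidedIdeal _ c
      (TwoSidedIdeal.subset_span (Set.mem_singleton (c ^ 2 • E c (algGen k n 0))))
    rwa [smul_smul, ← pow_succ', hc.cube_c, one_smul] at h1

/-- The ideal generated by the products of `a`- and `c`-eigenprojections of `s₁` and `s₂`. -/
noncomputable def pairIdeal (n : ℕ) (a c : k) : TwoSidedIdeal (MonoidAlgebra k (Γ n)) :=
  TwoSidedIdeal.span {E a (algGen k n 0) * E c (algGen k n 1),
    E c (algGen k n 0) * E a (algGen k n 1)}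

/-- In the quotient by the pair ideal the merged generators define Φ alongside the quotient map φ.
On (E_a(s₁)) the two agree and on (E_c(s₁)) Φ vanishes, so φ is zero on the intersection. -/
theorem span_inf_span_le (hn : 3 ≤ n) (hc : CubeRoots a b c) :
    TwoSidedIdeal.span {E a (algGen k n 0)} ⊓ TwoSidedIdeal.span {E c (algGen k n 0)} ≤
      pairIdeal n a c := by
  set P := pairIdeal n a c with hP
  set φ := quotMk k P with hφ
  set σ : ℕ → QuotAlg P := fun i => φ (algGen k n i) with hσ'
  have hσ : CubicBraid (n - 1) σ := (cubicBraid_algGen k n).map φ.toRingHom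
  have h1 : E a (σ 0) * E c (σ 1) = 0 := by
    rw [← map_eigIdem, ← map_eigIdem, ← map_mul]
    exact quotMk_eq_zero P (TwoSidedIdeal.subset_span (by simp))
  have h2 : E c (σ 0) * E a (σ 1) = 0 := by
    rw [← map_eigIdem, ← map_eigIdem, ← map_mul]
    exact quotMk_eq_zero P (TwoSidedIdeal.subset_span (by simp))
  have hac : ∀ i < n - 1, ∀ m < n - 1, E a (σ i) * E c (σ m) = 0 := by
    intro i hi m hm
    by_cases him : i = m
    · subst him
      exact eigIdem_orth hc.swap.rotate (hσ.cube i hi)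
    · exact hσ.eigIdem_mul_eq_zero hc h1 h2 i m hi hm him
  have hca : ∀ i < n - 1, ∀ m < n - 1, E c (σ i) * E a (σ m) = 0 := by
    intro i hi m hm
    by_cases him : i = m
    · subst him
      exact eigIdem_orth hc.rotate.rotate (hσ.cube i hi)
    · exact hσ.eigIdem_mul_eq_zero hc.swap.rotate.rotate h2 h1 i m hi hm him
  have hτ : CubicBraid (n - 1) (fun i => merge a b c (σ i)) := by
    refine ⟨fun i hi => merge_cube hc (hσ.cube i hi), fun i m him hi hm => ?_,
      fun i m him hi hm => ?_⟩
    · exact merge_braid hc (hσ.cube i hi) (hσ.cube m hm) (hσ.braid i m him hi hm) (hac i hi m hm)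
        (hca i hi m hm) (hac m hm i hi) (hca m hm i hi)
    · have h := commute_eigIdem a a (hσ.commute i m him hi hm)
      unfold merge
      exact (((Commute.one_left _).smul_left _).add_left (Commute.smul_left
        (((Commute.one_right _).smul_right _).add_right (h.smul_right _)) _))
  obtain ⟨Φ, hΦ⟩ := exists_algHom (k := k) hτ
  have hΦσ : ∀ i < n - 1, φ (algGen k n i) = Φ (algGen k n i) + a • E c (σ i) := fun i hi => by
    rw [hΦ i hi]
    exact merge_add hc (hσ.cube i hi)
  -- The annihilation by every E_c(σ_m) carries the induction: φ and Φ differ on a generator by a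
  -- multiple of E_c(σ_i), which such elements do not see.
  have hlow : ∀ x ∈ TwoSidedIdeal.span {E a (algGen k n 0)}, Φ x = φ x ∧
      ∀ m < n - 1, E c (σ m) * φ x = 0 ∧ φ x * E c (σ m) = 0 := by
    intro x hx
    induction hx using TwoSidedIdeal.span_induction with
    | mem x hx =>
      rw [Set.mem_singleton_iff.1 hx]
      have h0 : 0 < n - 1 := by omega
      rw [map_eigIdem, hΦ 0 h0, eigIdem_merge hc (hσ.cube 0 h0), map_eigIdem]
      exact ⟨rfl, fun m hm => ⟨hca m hm 0 h0, hac 0 h0 m hm⟩⟩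
    | zero => simp
    | add x y _ _ hx hy =>
      refine ⟨by rw [map_add, map_add, hx.1, hy.1], fun m hm => ⟨?_, ?_⟩⟩
      · rw [map_add, mul_add, (hx.2 m hm).1, (hy.2 m hm).1, add_zero]
      · rw [map_add, add_mul, (hx.2 m hm).2, (hy.2 m hm).2, add_zero]
    | neg x _ hx =>
      refine ⟨by rw [map_neg, map_neg, hx.1], fun m hm => ⟨?_, ?_⟩⟩
      · rw [map_neg, mul_neg, (hx.2 m hm).1, neg_zero]
      · rw [map_neg, neg_mul, (hx.2 m hm).2, neg_zero]
    | left_absorb y x _ hx =>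
      refine mul_left_induction (p := fun x => Φ x = φ x ∧
        ∀ m < n - 1, E c (σ m) * φ x = 0 ∧ φ x * E c (σ m) = 0) (AlgHom.id k _) ?_ ?_ ?_ y hx
      · intro x y hx hy
        refine ⟨by rw [map_add, map_add, hx.1, hy.1], fun m hm => ⟨?_, ?_⟩⟩
        · rw [map_add, mul_add, (hx.2 m hm).1, (hy.2 m hm).1, add_zero]
        · rw [map_add, add_mul, (hx.2 m hm).2, (hy.2 m hm).2, add_zero]
      · intro d x hx
        refine ⟨by rw [map_smul, map_smul, hx.1], fun m hm => ⟨?_, ?_⟩⟩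
        · rw [map_smul, mul_smul_comm, (hx.2 m hm).1, smul_zero]
        · rw [map_smul, smul_mul_assoc, (hx.2 m hm).2, smul_zero]
      · intro i hi x hx
        rw [AlgHom.id_apply]
        have e1 : φ (algGen k n i) * φ x = Φ (algGen k n i) * φ x := by
          rw [hΦσ i hi, add_mul, smul_mul_assoc, (hx.2 i hi).1, smul_zero, add_zero]
        refine ⟨by rw [map_mul, map_mul, hx.1, e1], fun m hm => ⟨?_, ?_⟩⟩
        · rw [map_mul, e1, hΦ i hi, merge, add_mul, smul_mul_assoc, one_mul, smul_mul_assoc,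
            mul_add, mul_smul_comm, mul_smul_comm, (hx.2 m hm).1, ← mul_assoc, hca m hm i hi]
          simp
        · rw [map_mul, mul_assoc, (hx.2 m hm).2, mul_zero]
    | right_absorb y x _ hx =>
      refine mul_right_induction (p := fun x => Φ x = φ x ∧
        ∀ m < n - 1, E c (σ m) * φ x = 0 ∧ φ x * E c (σ m) = 0) (AlgHom.id k _) ?_ ?_ ?_ y hx
      · intro x y hx hy
        refine ⟨by rw [map_add, map_add, hx.1, hy.1], fun m hm => ⟨?_, ?_⟩⟩
        · rw [map_add, mul_add, (hx.2 m hm).1, (hy.2 m hm).1, add_zero]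
        · rw [map_add, add_mul, (hx.2 m hm).2, (hy.2 m hm).2, add_zero]
      · intro d x hx
        refine ⟨by rw [map_smul, map_smul, hx.1], fun m hm => ⟨?_, ?_⟩⟩
        · rw [map_smul, mul_smul_comm, (hx.2 m hm).1, smul_zero]
        · rw [map_smul, smul_mul_assoc, (hx.2 m hm).2, smul_zero]
      · intro i hi x hx
        rw [AlgHom.id_apply]
        have e1 : φ x * φ (algGen k n i) = φ x * Φ (algGen k n i) := by
          rw [hΦσ i hi, mul_add, mul_smul_comm, (hx.2 i hi).2, smul_zero, add_zero]
        refine ⟨by rw [map_mul, map_mul, hx.1, e1], fun m hm => ⟨?_, ?_⟩⟩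
        · rw [map_mul, ← mul_assoc, (hx.2 m hm).1, zero_mul]
        · rw [map_mul, e1, hΦ i hi, merge, mul_add, mul_smul_comm, mul_one, mul_smul_comm,
            add_mul, smul_mul_assoc, smul_mul_assoc, (hx.2 m hm).2, mul_assoc, hac i hi m hm]
          simp
  have hhigh : TwoSidedIdeal.span {E c (algGen k n 0)} ≤ TwoSidedIdeal.ker Φ := by
    rw [← heckeIdeal_eq_span hn hc, heckeIdeal, TwoSidedIdeal.span_le]
    rintro _ rfl
    rw [SetLike.mem_coe, TwoSidedIdeal.mem_ker, toAlg_s₁, map_mul, map_sub, map_sub,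
      AlgHom.commutes, AlgHom.commutes, hΦ 0 (by omega)]
    exact merge_quadratic hc (hσ.cube 0 (by omega))
  intro x hx
  rw [TwoSidedIdeal.mem_inf] at hx
  rw [← quotMk_eq_zero_iff (k := k), ← hφ, ← (hlow x hx.1).1]
  exact (TwoSidedIdeal.mem_ker _).1 (hhigh hx.2)

/-- Sandwiching the relation between E_a(s) and E_c(s) replaces s by scalars and leaves b·t² + b²·t
in the middle, which is E_b(t) up to the term 1, and E_a(s)E_c(s) = 0. -/
theorem eigIdem_mul_mul_of_b (hc : CubeRoots a b c) {R : Type*} [Ring R] [Algebra k R] {s t : R}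
    (hs : s ^ 3 = 1) (h : s * t ^ 2 + t ^ 2 * s + s ^ 2 * t + t * s ^ 2 = 0) :
    E a s * E b t * E c s = 0 := by
  have l1 : E a s * s = a • E a s := eigIdem_mul hc.cube_a hs
  have l2 : E a s * s ^ 2 = a ^ 2 • E a s := by
    rw [pow_two, ← mul_assoc, l1, smul_mul_assoc, l1, smul_smul, pow_two]
  have r1 : s * E c s = c • E c s := mul_eigIdem hc.cube_c hs
  have r2 : s ^ 2 * E c s = c ^ 2 • E c s := by
    rw [pow_two, mul_assoc, r1, mul_smul_comm, r1, smul_smul, pow_two]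
  have h0 : E a s * E c s = 0 := eigIdem_orth hc.swap.rotate hs
  have h1 : E a s * (s * t ^ 2 + t ^ 2 * s + s ^ 2 * t + t * s ^ 2) * E c s =
      b • (E a s * t ^ 2 * E c s) + b ^ 2 • (E a s * t * E c s) := by
    have e1 : E a s * (s * t ^ 2 + t ^ 2 * s + s ^ 2 * t + t * s ^ 2) * E c s =
      (E a s * s) * t ^ 2 * E c s + E a s * t ^ 2 * (s * E c s) + (E a s * s ^ 2) * t * E c s +
        E a s * t * (s ^ 2 * E c s) := by
      simp only [mul_add, add_mul, mul_assoc]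
    rw [e1, l1, l2, r1, r2]
    simp only [smul_mul_assoc, mul_smul_comm]
    match_scalars <;> grind [hc.two, hc.sum]
  have h2 : E a s * E b t * E c s =
      b • (E a s * t ^ 2 * E c s) + b ^ 2 • (E a s * t * E c s) := by
    conv_lhs => rw [eigIdem.eq_1 b]
    simp only [mul_add, add_mul, mul_one, smul_mul_assoc, mul_smul_comm, h0, zero_add]
    abel
  rw [h2, ← h1, h, mul_zero, zero_mul]

/-- Modulo **b** the generators form a `TernarySystem`. Both generators of the pair ideal are
`Killed` there, and this property survives multiplication on either side. -/
theorem eigIdem_mul_mem_span_b (hn : 3 ≤ n) (hc : CubeRoots a b c)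
    {x : MonoidAlgebra k (Γ n)} (hx : x ∈ pairIdeal n a c) :
    E b (algGen k n 0) * x ∈ TwoSidedIdeal.span {TernaryHecke.b k hn} := by
  set P := TwoSidedIdeal.span {TernaryHecke.b k hn} with hP
  set φ := quotMk k P with hφ
  set σ : ℕ → QuotAlg P := fun i => φ (algGen k n i) with hσ'
  have hb : CubicBraid (n - 1) σ := (cubicBraid_algGen k n).map φ.toRingHom
  have hb0 : σ 0 * σ 1 ^ 2 + σ 1 ^ 2 * σ 0 + σ 0 ^ 2 * σ 1 + σ 1 * σ 0 ^ 2 = 0 := by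
    simp only [hσ', ← map_pow, ← map_mul, ← map_add]
    rw [← b_eq hn]
    exact quotMk_eq_zero P (TwoSidedIdeal.subset_span rfl)
  have hσ : TernarySystem k (n - 1) σ := by
    refine ⟨hb.cube, fun i m him hi hm => ?_, hb.commute⟩
    have hconj : ∀ i m, Neighbours i m → i < n - 1 → m < n - 1 → ∀ a b c : k, CubeRoots a b c →
        E a (σ i) * E b (σ m) * E c (σ i) = 0 := by
      intro i m him hi hm a b c hc
      obtain ⟨w, hw, e0, e1⟩ := hb.exists_conj him hi hm
      have h1 : w * (E a (σ 0) * E b (σ 1) * E c (σ 0)) =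
          E a (σ i) * E b (σ m) * E c (σ i) * w := by
        rw [← mul_assoc, eigIdem_mul_conj a b e0 e1, mul_assoc, intertwine_eigIdem c e0, mul_assoc,
          mul_assoc, mul_assoc]
      rwa [eigIdem_mul_mul_of_b hc (hb.cube 0 (by omega)) hb0, mul_zero, eq_comm,
        hw.mul_left_eq_zero] at h1
    exact ⟨hb.cube i hi, hb.cube m hm, hb.braid i m him hi hm, hconj i m him hi hm,
      hconj m i him.symm hm hi⟩
  have hk : Killed (n - 1) σ a b c (φ x) := by
    induction hx using TwoSidedIdeal.span_induction with
    | mem x hx =>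
      rcases hx with rfl | hx
      · have := hσ.killed (by omega) hc 1
        rwa [mul_one, ← map_eigIdem, ← map_eigIdem, ← map_mul] at this
      · rw [Set.mem_singleton_iff.1 hx]
        have := (hσ.killed (by omega) hc.swap.rotate.rotate 1).swap
        rwa [mul_one, ← map_eigIdem, ← map_eigIdem, ← map_mul] at this
    | zero => simpa using (hσ.killed (by omega) hc 0)
    | add x y _ _ hx hy =>
      rw [map_add]
      exact hx.add hy
    | neg x _ hx =>
      rw [map_neg, hc.neg_eq]
      exact hx
    | left_absorb y x _ hx =>
      rw [map_mul]
      exact mul_left_induction (p := Killed (n - 1) σ a b c) φ (fun _ _ => Killed.add)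
        (fun d _ h => h.smul d) (fun i hi _ h => h.mul_left hσ hc i hi) y hx
    | right_absorb y x _ hx =>
      rw [map_mul]
      exact hx.mul_right _
  rw [← quotMk_eq_zero_iff (k := k), map_mul, map_eigIdem]
  exact hk.base 0 (by omega)

theorem hecke_quadratic (hn : 3 ≤ n) (hc : CubeRoots a b c) (i : ℕ) (hi : i < n - 1) :
    quotMk k (heckeIdeal hn a b) (algGen k n i) ^ 2 =
      c • quotMk k (heckeIdeal hn a b) (algGen k n i) + c ^ 2 • 1 := by
  set φ := quotMk k (heckeIdeal hn a b) with hφ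
  set σ : ℕ → Hecke hn a b := fun i => φ (algGen k n i) with hσ'
  have hσ : CubicBraid (n - 1) σ := (cubicBraid_algGen k n).map φ.toRingHom
  have h0 : E c (σ 0) = 0 := by
    rw [← map_eigIdem, hφ, quotMk_eq_zero_iff, heckeIdeal_eq_span hn hc]
    exact TwoSidedIdeal.subset_span rfl
  have h1 : E c (σ i) = 0 := by
    have : ∃ w, IsUnit w ∧ w * σ 0 = σ i * w := by
      rcases Nat.eq_zero_or_pos i with rfl | hpos
      · obtain ⟨w, hw, h, -⟩ := hσ.exists_conj (i := 0) (m := 1) (Or.inl rfl) hi (by omega)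
        exact ⟨w, hw, h⟩
      · obtain ⟨w, hw, h, -⟩ := hσ.exists_conj (i := i) (m := i - 1)
          (Or.inr (by omega)) hi (by omega)
        exact ⟨w, hw, h⟩
    obtain ⟨w, hw, h⟩ := this
    have h2 := intertwine_eigIdem c h
    rwa [h0, mul_zero, eq_comm, hw.mul_left_eq_zero] at h2
  have h2 := congrArg (c ^ 2 • ·) h1
  simp only [eigIdem, smul_add, smul_smul, smul_zero] at h2
  rw [← pow_succ, hc.cube_c, one_smul] at h2
  have h3 : σ i ^ 2 = -(c ^ 2 • 1 + (c ^ 2 * c ^ 2) • σ i) := eq_neg_of_add_eq_zero_right h2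
  change σ i ^ 2 = c • σ i + c ^ 2 • 1
  rw [h3, hc.neg_eq, ← pow_add, show c ^ (2 + 2) = c by linear_combination c * hc.cube_c, add_comm]

theorem b_mem_heckeIdeal (hn : 3 ≤ n) (hc : CubeRoots a b c) :
    TernaryHecke.b k hn ∈ heckeIdeal hn a b := by
  rw [← quotMk_eq_zero_iff (k := k), b_eq]
  simp only [map_add, map_mul, map_pow, hecke_quadratic hn hc 0 (by omega),
    hecke_quadratic hn hc 1 (by omega), mul_add, add_mul, mul_smul_comm, smul_mul_assoc, mul_one,
    one_mul]
  match_scalars <;> first | linear_combination c * hc.two | linear_combination c ^ 2 * hc.two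

theorem q_eq (hn : 3 ≤ n) : q k hn = 1 + algGen k n 0 * algGen k n 1 ^ 2 +
    algGen k n 1 * algGen k n 0 ^ 2 + algGen k n 0 ^ 2 * algGen k n 1 +
    algGen k n 1 ^ 2 * algGen k n 0 + algGen k n 0 * algGen k n 1 * algGen k n 0 +
    algGen k n 0 ^ 2 * algGen k n 1 ^ 2 * algGen k n 0 ^ 2 +
    algGen k n 0 * algGen k n 1 ^ 2 * algGen k n 0 * algGen k n 1 ^ 2 := by
  simp only [q, toAlg_mul, toAlg_pow, toAlg_s₁, toAlg_s₂]

/-- The quadratic relations and one direction of the braid relation reduce each word to a normal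
form; the coefficients cancel in characteristic 2. -/
theorem quaternion_sum_eq_zero (hc : CubeRoots a b c) {R : Type*} [Ring R] [Algebra k R] {s t : R}
    (hs : s ^ 2 = c • s + c ^ 2 • 1) (ht : t ^ 2 = c • t + c ^ 2 • 1)
    (hst : s * t * s = t * s * t) :
    1 + s * t ^ 2 + t * s ^ 2 + s ^ 2 * t + t ^ 2 * s + s * t * s + s ^ 2 * t ^ 2 * s ^ 2 +
      s * t ^ 2 * s * t ^ 2 = 0 := by
  have hs' : s * s = c • s + c ^ 2 • 1 := by rw [← pow_two, hs]
  have hs'' : ∀ x, s * (s * x) = c • (s * x) + c ^ 2 • x := fun x => by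
    rw [← mul_assoc, hs', add_mul, smul_mul_assoc, smul_mul_assoc, one_mul]
  have hb : t * (s * t) = s * (t * s) := by rw [← mul_assoc, ← mul_assoc, hst]
  simp only [hs, ht, mul_add, add_mul, mul_smul_comm, smul_mul_assoc, mul_one, one_mul, mul_assoc,
    hs', hs'', hb, smul_add, smul_smul]
  match_scalars <;> grind [hc.two, hc.cube_c]

theorem q_mem_heckeIdeal (hn : 3 ≤ n) (hc : CubeRoots a b c) : q k hn ∈ heckeIdeal hn a b := by
  rw [← quotMk_eq_zero_iff (k := k), q_eq]
  simp only [map_add, map_mul, map_pow, map_one]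
  refine quaternion_sum_eq_zero hc (hecke_quadratic hn hc 0 (by omega))
    (hecke_quadratic hn hc 1 (by omega)) ?_
  simp only [← map_mul]
  rw [(cubicBraid_algGen k n).braid 0 1 (Or.inl rfl) (by omega) (by omega)]

theorem inf_eq_span_b (hn : 3 ≤ n) (hc : CubeRoots a b c) :
    heckeIdeal hn a b ⊓ heckeIdeal hn a c ⊓ heckeIdeal hn b c =
      TwoSidedIdeal.span {TernaryHecke.b k hn} := by
  have hacb := hc.swap.rotate
  have hbca := hc.rotate
  apply le_antisymm
  · intro x hx
    simp only [TwoSidedIdeal.mem_inf, heckeIdeal_eq_span hn hc, heckeIdeal_eq_span hn hacb,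
      heckeIdeal_eq_span hn hbca] at hx
    obtain ⟨⟨h1, h2⟩, h3⟩ := hx
    have key : ∀ {a b c : k}, CubeRoots a b c →
        x ∈ TwoSidedIdeal.span {E a (algGen k n 0)} →
        x ∈ TwoSidedIdeal.span {E c (algGen k n 0)} →
        E b (algGen k n 0) * x ∈ TwoSidedIdeal.span {TernaryHecke.b k hn} := fun hc h h' =>
      eigIdem_mul_mem_span_b hn hc (span_inf_span_le hn hc
        ((TwoSidedIdeal.mem_inf _).2 ⟨h, h'⟩))
    -- Each colour in turn plays the part of b, with the Hecke ideals omitting the other two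
    -- supplying the hypotheses.
    rw [← eigIdem_decomp hc (algGen k n 0) x]
    exact add_mem (add_mem (key hc.swap h2 h1) (key hc h3 h1)) (key hacb h3 h2)
  · rw [TwoSidedIdeal.span_le]
    rintro _ rfl
    simp only [SetLike.mem_coe, TwoSidedIdeal.mem_inf]
    exact ⟨⟨b_mem_heckeIdeal hn hc, b_mem_heckeIdeal hn hacb⟩, b_mem_heckeIdeal hn hbca⟩

end Ideals

/-! ### Upper bound n! by coset normal forms -/

section Span

variable {k R : Type*} [CommRing k] [Ring R] [Algebra k R] {N : ℕ} {σ : ℕ → R}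

/-- The product `σ m * σ (m - 1) * ⋯` with `j` factors. -/
def descProd (σ : ℕ → R) (m : ℕ) : ℕ → R
  | 0 => 1
  | j + 1 => descProd σ m j * σ (m - j)

theorem CubicBraid.descProd_comm (h : CubicBraid N σ) {m : ℕ} (hm : m < N) {i j : ℕ}
    (hij : i + j < m) : descProd σ m j * σ i = σ i * descProd σ m j := by
  induction j with
  | zero => simp [descProd]
  | succ j ih =>
    have h1 := (h.commute (m - j) i (by unfold Neighbours; omega) (by omega) (by omega)).eq
    rw [descProd, mul_assoc, h1, ← mul_assoc, ih (by omega), mul_assoc]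

theorem CubicBraid.descProd_shift (h : CubicBraid N σ) {m : ℕ} (hm : m < N) {i j : ℕ}
    (hj : j ≤ m + 1) (hi : m + 1 < i + 1 + j) (him : i < m) :
    descProd σ m j * σ (i + 1) = σ i * descProd σ m j := by
  induction j with
  | zero => omega
  | succ j ih =>
    by_cases hij : m + 1 < i + 1 + j
    · have h1 := (h.commute (m - j) (i + 1) (by unfold Neighbours; omega) (by omega) (by omega)).eq
      rw [descProd, mul_assoc, h1, ← mul_assoc, ih (by omega) hij, mul_assoc]
    · obtain ⟨j, rfl⟩ : ∃ j', j = j' + 1 := ⟨j - 1, by omega⟩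
      have h1 := h.braid (i + 1) i (Or.inr rfl) (by omega) (by omega)
      have h2 := h.descProd_comm hm (i := i) (j := j) (by omega)
      rw [descProd, descProd, show m - j = i + 1 by omega, show m - (j + 1) = i by omega,
        mul_assoc, mul_assoc, ← mul_assoc (σ (i + 1)), h1, ← mul_assoc, ← mul_assoc, h2]
      simp only [mul_assoc]

open Classical in
/-- A spanning set of `(m + 1)!` elements of the algebra generated by `m` quadratic braid
generators. -/
noncomputable def spanSet (σ : ℕ → R) : ℕ → Finset R
  | 0 => {1}
  | m + 1 => (spanSet σ m ×ˢ Finset.range (m + 2)).image fun p => p.1 * descProd σ m p.2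

open Classical in
theorem card_spanSet_le (σ : ℕ → R) (m : ℕ) : (spanSet σ m).card ≤ (m + 1).factorial := by
  induction m with
  | zero => simp [spanSet]
  | succ m ih =>
    rw [spanSet]
    refine Finset.card_image_le.trans ?_
    rw [Finset.card_product, Finset.card_range, Nat.factorial_succ (m + 1), mul_comm]
    gcongr

theorem mul_descProd_mem (k : Type*) [CommRing k] [Algebra k R] (σ : ℕ → R) {m j : ℕ}
    (hj : j < m + 2) {v : R} (hv : v ∈ Submodule.span k (spanSet σ m : Set R)) :
    v * descProd σ m j ∈ Submodule.span k (spanSet σ (m + 1) : Set R) := by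
  classical
  induction hv using Submodule.span_induction with
  | mem x hx =>
    refine Submodule.subset_span ?_
    rw [spanSet, Finset.coe_image]
    exact ⟨(x, j), by simpa using ⟨hx, hj⟩, rfl⟩
  | zero => simp
  | add x y _ _ hx hy => rw [add_mul]; exact add_mem hx hy
  | smul d x _ hx => rw [smul_mul_assoc]; exact Submodule.smul_mem _ _ hx

theorem one_mem_span_spanSet (k : Type*) [CommRing k] [Algebra k R] (σ : ℕ → R) (m : ℕ) :
    (1 : R) ∈ Submodule.span k (spanSet σ m : Set R) := by
  induction m with
  | zero => exact Submodule.subset_span (by simp [spanSet])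
  | succ m ih =>
    have := mul_descProd_mem k σ (j := 0) (by omega) ih
    rwa [descProd, mul_one] at this

/-- Right multiplication of v·σ_m⋯σ_{m-j+1} by σ_i lengthens the tail, meets its last factor
(quadratic relation), or passes through it to σ_i or σ_{i-1}, which acts on v by induction. -/
theorem CubicBraid.mul_mem_span_spanSet (h : CubicBraid N σ) (c d : k)
    (hq : ∀ i < N, σ i ^ 2 = c • σ i + d • 1) (m : ℕ) (hm : m ≤ N) (i : ℕ) (hi : i < m) {v : R}
    (hv : v ∈ Submodule.span k (spanSet σ m : Set R)) :
    v * σ i ∈ Submodule.span k (spanSet σ m : Set R) := by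
  classical
  induction m generalizing i v with
  | zero => omega
  | succ m ih =>
    induction hv using Submodule.span_induction with
    | mem x hx =>
      rw [Finset.mem_coe, spanSet, Finset.mem_image] at hx
      obtain ⟨⟨v, j⟩, hp, rfl⟩ := hx
      rw [Finset.mem_product, Finset.mem_range] at hp
      obtain ⟨hv, hj⟩ := hp
      replace hv := Submodule.subset_span (R := k) (Finset.mem_coe.2 hv)
      dsimp only at hj hv ⊢
      rcases (by omega : i + j < m ∨ i + j = m ∨ i + j = m + 1 ∨ m + 1 < i + j) with
        h1 | h1 | h1 | h1
      · rw [mul_assoc, h.descProd_comm (by omega) h1, ← mul_assoc]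
        exact mul_descProd_mem k σ hj (ih (by omega) i (by omega) hv)
      · have : descProd σ m j * σ i = descProd σ m (j + 1) := by
          rw [descProd, show m - j = i by omega]
        rw [mul_assoc, this]
        exact mul_descProd_mem k σ (by omega) hv
      · obtain ⟨j, rfl⟩ : ∃ j', j = j' + 1 := ⟨j - 1, by omega⟩
        have : descProd σ m (j + 1) * σ i = c • descProd σ m (j + 1) + d • descProd σ m j := by
          rw [descProd, show m - j = i by omega, mul_assoc, ← pow_two, hq i (by omega), mul_add,
            mul_smul_comm, mul_smul_comm, mul_one]
        rw [mul_assoc, this, mul_add, mul_smul_comm, mul_smul_comm]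
        exact add_mem (Submodule.smul_mem _ _ (mul_descProd_mem k σ hj hv))
          (Submodule.smul_mem _ _ (mul_descProd_mem k σ (by omega) hv))
      · obtain ⟨i, rfl⟩ : ∃ i', i = i' + 1 := ⟨i - 1, by omega⟩
        rw [mul_assoc, h.descProd_shift (by omega) (by omega) (by omega) (by omega), ← mul_assoc]
        exact mul_descProd_mem k σ hj (ih (by omega) i (by omega) hv)
    | zero => simp
    | add x y _ _ hx hy => rw [add_mul]; exact add_mem hx hy
    | smul d x _ hx => rw [smul_mul_assoc]; exact Submodule.smul_mem _ _ hx

end Span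

/-! ### The regular representation on permutations -/

section Regular

variable {k : Type*} [CommRing k] {ι : Type*}

/-- The basis vector of a permutation. -/
noncomputable def permVec (k : Type*) [CommRing k] {ι : Type*} (w : Equiv.Perm ι) :
    Equiv.Perm ι →₀ k :=
  Finsupp.single w 1

theorem perm_module_end_ext {f g : Module.End k (Equiv.Perm ι →₀ k)}
    (h : ∀ w, f (permVec k w) = g (permVec k w)) : f = g :=
  Finsupp.lhom_ext' fun w => LinearMap.ext_ring (h w)

theorem span_permVec : Submodule.span k (Set.range (permVec k (ι := ι))) = ⊤ :=
  (congrArg (fun f => Submodule.span k (Set.range f)) Finsupp.coe_basisSingleOne).symm.trans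
    Finsupp.basisSingleOne.span_eq

variable [LinearOrder ι]

/-- The operator of right multiplication by the Hecke generator for the transposition of the
positions `p` and `q`, on the module with basis the permutations; its eigenvalues are the roots of
`X ^ 2 = c X + d`. -/
noncomputable def heckeOp (c d : k) (p q : ι) : Module.End k (Equiv.Perm ι →₀ k) :=
  Finsupp.lift (Equiv.Perm ι →₀ k) k (Equiv.Perm ι) fun w =>
    if w p < w q then permVec k (w * Equiv.swap p q)
    else c • permVec k w + d • permVec k (w * Equiv.swap p q)

variable (c d : k) {p q r u : ι}

theorem heckeOp_permVec (p q : ι) (w : Equiv.Perm ι) :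
    heckeOp c d p q (permVec k w) =
      if w p < w q then permVec k (w * Equiv.swap p q)
      else c • permVec k w + d • permVec k (w * Equiv.swap p q) := by
  have h : ∀ f : Equiv.Perm ι → Equiv.Perm ι →₀ k,
      Finsupp.lift (Equiv.Perm ι →₀ k) k (Equiv.Perm ι) f (permVec k w) = f w := fun f => by
    rw [permVec, Finsupp.lift_apply, Finsupp.sum_single_index, one_smul]
    exact zero_smul _ _
  exact h _

theorem heckeOp_asc {w : Equiv.Perm ι} (h : w p < w q) :
    heckeOp c d p q (permVec k w) = permVec k (w * Equiv.swap p q) := by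
  rw [heckeOp_permVec, if_pos h]

theorem heckeOp_desc {w : Equiv.Perm ι} (h : w q < w p) :
    heckeOp c d p q (permVec k w) = c • permVec k w + d • permVec k (w * Equiv.swap p q) := by
  rw [heckeOp_permVec, if_neg h.not_gt]

theorem heckeOp_sq (hpq : p ≠ q) :
    heckeOp c d p q ^ 2 = c • heckeOp c d p q + d • 1 := by
  refine perm_module_end_ext fun w => ?_
  have hne : w p ≠ w q := fun h => hpq (w.injective h)
  rw [pow_two, Module.End.mul_apply, LinearMap.add_apply, LinearMap.smul_apply,
    LinearMap.smul_apply, Module.End.one_apply]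
  rcases lt_or_gt_of_ne hne with h | h
  · rw [heckeOp_asc c d h, heckeOp_desc c d (by simpa using h), mul_assoc, Equiv.swap_mul_self,
      mul_one]
  · rw [heckeOp_desc c d h, map_add, map_smul, map_smul, heckeOp_desc c d h,
      heckeOp_asc c d (by simpa using h), mul_assoc, Equiv.swap_mul_self, mul_one]

theorem heckeOp_comm (hpr : p ≠ r) (hpu : p ≠ u) (hqr : q ≠ r) (hqu : q ≠ u) :
    Commute (heckeOp c d p q) (heckeOp c d r u) := by
  refine perm_module_end_ext fun w => ?_
  have hsw : w * Equiv.swap r u * Equiv.swap p q = w * Equiv.swap p q * Equiv.swap r u := by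
    rw [mul_assoc, Equiv.mul_swap_eq_swap_mul (Equiv.swap r u),
      Equiv.swap_apply_of_ne_of_ne hpr hpu, Equiv.swap_apply_of_ne_of_ne hqr hqu, mul_assoc]
  have e1 : (w * Equiv.swap r u) p = w p := by simp [Equiv.swap_apply_of_ne_of_ne hpr hpu]
  have e2 : (w * Equiv.swap r u) q = w q := by simp [Equiv.swap_apply_of_ne_of_ne hqr hqu]
  have e3 : (w * Equiv.swap p q) r = w r := by simp [Equiv.swap_apply_of_ne_of_ne hpr.symm hqr.symm]
  have e4 : (w * Equiv.swap p q) u = w u := by simp [Equiv.swap_apply_of_ne_of_ne hpu.symm hqu.symm]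
  rw [Module.End.mul_apply, Module.End.mul_apply]
  by_cases h1 : w p < w q <;> by_cases h2 : w r < w u <;>
    simp only [heckeOp_permVec, h1, h2, e1, e2, e3, e4, if_true, if_false, map_add, map_smul,
      hsw, smul_add]
  module

theorem heckeOp_braid (hpq : p ≠ q) (hpr : p ≠ r) (hqr : q ≠ r) :
    heckeOp c d p q * heckeOp c d q r * heckeOp c d p q =
      heckeOp c d q r * heckeOp c d p q * heckeOp c d q r := by
  refine perm_module_end_ext fun w => ?_
  have hsw : w * Equiv.swap q r * Equiv.swap p q * Equiv.swap q r =
      w * Equiv.swap p q * Equiv.swap q r * Equiv.swap p q := by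
    have h1 := Equiv.swap_mul_swap_mul_swap hpq hpr
    have h2 := Equiv.swap_mul_swap_mul_swap hqr.symm hpr.symm
    rw [Equiv.swap_comm r p, ← h2, Equiv.swap_comm q p, Equiv.swap_comm r q] at h1
    rw [mul_assoc, mul_assoc, mul_assoc, mul_assoc]
    simpa only [mul_assoc] using congrArg (w * ·) h1
  have hpp : ∀ v : Equiv.Perm ι, v * Equiv.swap p q * Equiv.swap p q = v := fun v => by
    rw [mul_assoc, Equiv.swap_mul_self, mul_one]
  have hqq : ∀ v : Equiv.Perm ι, v * Equiv.swap q r * Equiv.swap q r = v := fun v => by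
    rw [mul_assoc, Equiv.swap_mul_self, mul_one]
  have e1 : Equiv.swap q r p = p := Equiv.swap_apply_of_ne_of_ne hpq hpr
  have e2 : Equiv.swap p q r = r := Equiv.swap_apply_of_ne_of_ne hpr.symm hqr.symm
  have n1 : w p ≠ w q := fun h => hpq (w.injective h)
  have n2 : w p ≠ w r := fun h => hpr (w.injective h)
  have n3 : w q ≠ w r := fun h => hqr (w.injective h)
  simp only [Module.End.mul_apply]
  -- Of the eight sign patterns, the two cyclic ones are contradictory; the six orderings of w p, w
  -- q, w r are computed.
  rcases lt_or_gt_of_ne n1 with h1 | h1 <;> rcases lt_or_gt_of_ne n2 with h2 | h2 <;>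
    rcases lt_or_gt_of_ne n3 with h3 | h3 <;>
    first
    | exact absurd (h1.trans h3) h2.not_gt
    | exact absurd (h3.trans h1) h2.not_gt
    | (simp only [heckeOp_permVec, Equiv.Perm.mul_apply, Equiv.swap_apply_left,
        Equiv.swap_apply_right, e1, e2, h1, h2, h3, h1.not_gt, h2.not_gt, h3.not_gt, if_true,
        if_false, map_add, map_smul, hsw, hpp, hqq]
       try module)

end Regular

/-! ### The Hecke algebras have dimension n! -/

section Dimension

variable {k : Type*} [Field k] {n : ℕ} {a b c : k}

theorem quotMk_surjective {A : Type*} [Ring A] [Algebra k A] (I : TwoSidedIdeal A) :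
    Function.Surjective (quotMk k I) :=
  I.ringCon.mk'_surjective

theorem hecke_span (hn : 3 ≤ n) (hc : CubeRoots a b c) :
    Submodule.span k (spanSet (fun i => quotMk k (heckeIdeal hn a b) (algGen k n i)) (n - 1) :
      Set (Hecke hn a b)) = ⊤ := by
  rw [eq_top_iff]
  rintro x -
  obtain ⟨y, rfl⟩ := quotMk_surjective (k := k) _ x
  have hσ := (cubicBraid_algGen k n).map (quotMk k (heckeIdeal hn a b)).toRingHom
  have := mul_right_induction (p := fun x => x ∈ Submodule.span k
    (spanSet (fun i => quotMk k (heckeIdeal hn a b) (algGen k n i)) (n - 1) :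
      Set (Hecke hn a b))) (quotMk k (heckeIdeal hn a b)) (fun _ _ hx hy => add_mem hx hy)
    (fun d _ hx => Submodule.smul_mem _ d hx)
    (fun i hi _ hx => hσ.mul_mem_span_spanSet c (c ^ 2) (hecke_quadratic hn hc) (n - 1) le_rfl i
      hi hx) y (one_mem_span_spanSet k _ _)
  rwa [one_mul] at this

theorem finite_hecke (hn : 3 ≤ n) (hc : CubeRoots a b c) : Module.Finite k (Hecke hn a b) :=
  ⟨⟨_, hecke_span hn hc⟩⟩

theorem finrank_hecke_le (hn : 3 ≤ n) (hc : CubeRoots a b c) :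
    Module.finrank k (Hecke hn a b) ≤ n.factorial := by
  rw [← finrank_top, ← hecke_span hn hc]
  refine (finrank_span_finset_le_card _).trans ((card_spanSet_le _ _).trans ?_)
  rw [Nat.sub_add_cancel (by omega)]

/-- The regular representation of the Hecke algebra, on the generators. -/
noncomputable def regGen (c : k) (n i : ℕ) : Module.End k (Equiv.Perm (Fin n) →₀ k) :=
  if h : i + 1 < n then heckeOp c (c ^ 2) ⟨i, by omega⟩ ⟨i + 1, h⟩ else 1

theorem regGen_eq (c : k) {i : ℕ} (hi : i + 1 < n) :
    regGen c n i = heckeOp c (c ^ 2) (⟨i, by omega⟩ : Fin n) ⟨i + 1, hi⟩ := by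
  rw [regGen, dif_pos hi]

theorem regGen_sq (c : k) {i : ℕ} (hi : i + 1 < n) :
    regGen c n i ^ 2 = c • regGen c n i + c ^ 2 • 1 := by
  rw [regGen_eq c hi]
  exact heckeOp_sq c (c ^ 2) (by simp)

theorem cubicBraid_regGen (hc : CubeRoots a b c) : CubicBraid (n - 1) (regGen c n) := by
  have hbraid : ∀ i, i + 2 < n → regGen c n i * regGen c n (i + 1) * regGen c n i =
      regGen c n (i + 1) * regGen c n i * regGen c n (i + 1) := by
    intro i hi
    rw [regGen_eq c (by omega : i + 1 < n), regGen_eq c (by omega : i + 1 + 1 < n)]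
    exact heckeOp_braid c (c ^ 2) (by simp) (by simp; omega) (by simp)
  refine ⟨fun i hi => ?_, fun i m him hi hm => ?_, fun i m him hi hm => ?_⟩
  · rw [pow_succ, regGen_sq c (by omega : i + 1 < n), add_mul, smul_mul_assoc, smul_mul_assoc,
      one_mul, ← pow_two, regGen_sq c (by omega : i + 1 < n)]
    match_scalars <;> grind [hc.two, hc.cube_c]
  · rcases him with rfl | rfl
    · exact hbraid i (by omega)
    · exact (hbraid m (by omega)).symm
  · by_cases h : i = m
    · subst h
      exact Commute.refl _
    · unfold Neighbours at him
      rw [regGen_eq c (by omega : i + 1 < n), regGen_eq c (by omega : m + 1 < n)]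
      refine heckeOp_comm c (c ^ 2) ?_ ?_ ?_ ?_ <;> simp <;> omega

/-- The universal property of the Hecke algebra. -/
theorem exists_hecke_algHom (hn : 3 ≤ n) (hc : CubeRoots a b c) {R : Type*} [Ring R] [Algebra k R]
    {σ : ℕ → R} (h : CubicBraid (n - 1) σ) (hq : σ 0 ^ 2 = c • σ 0 + c ^ 2 • 1) :
    ∃ ψ : Hecke hn a b →ₐ[k] R, ∀ i < n - 1, ψ (quotMk k _ (algGen k n i)) = σ i := by
  obtain ⟨φ, hφ⟩ := exists_algHom (k := k) h
  have hker : heckeIdeal hn a b ≤ TwoSidedIdeal.ker φ := by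
    rw [heckeIdeal_eq_span hn hc, TwoSidedIdeal.span_le]
    rintro _ rfl
    rw [SetLike.mem_coe, TwoSidedIdeal.mem_ker, map_eigIdem, hφ 0 (by omega), eigIdem, hq]
    match_scalars <;> grind [hc.two, hc.cube_c]
  exact ⟨quotLift k (heckeIdeal hn a b) φ fun x hx => (TwoSidedIdeal.mem_ker _).1 (hker hx), hφ⟩

/-- The orbit map of the identity permutation is onto: its image is stable under the generators, and
adjacent transpositions generate the symmetric group. -/
theorem factorial_le_finrank_hecke (hn : 3 ≤ n) (hc : CubeRoots a b c) :
    n.factorial ≤ Module.finrank k (Hecke hn a b) := by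
  have := finite_hecke hn hc
  obtain ⟨ψ, hψ⟩ := exists_hecke_algHom hn hc (cubicBraid_regGen (n := n) hc)
    (regGen_sq c (by omega : 0 + 1 < n))
  let ev : Hecke hn a b →ₗ[k] (Equiv.Perm (Fin n) →₀ k) :=
    (LinearMap.applyₗ (permVec k 1)).comp ψ.toLinearMap
  have hev : ∀ i, i + 1 < n → ∀ x ∈ LinearMap.range ev, regGen c n i x ∈ LinearMap.range ev := by
    rintro i hi _ ⟨y, rfl⟩
    refine ⟨quotMk k (heckeIdeal hn a b) (algGen k n i) * y, ?_⟩
    change ψ (_ * y) (permVec k 1) = _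
    rw [map_mul, hψ i (by omega)]
    rfl
  have hswap : ∀ (i : ℕ) (hi : i + 1 < n) (w : Equiv.Perm (Fin n)),
      permVec k w ∈ LinearMap.range ev →
      permVec k (w * Equiv.swap (⟨i, by omega⟩ : Fin n) ⟨i + 1, hi⟩) ∈ LinearMap.range ev := by
    intro i hi w hw
    have h1 := hev i hi _ hw
    rw [regGen_eq c hi, heckeOp_permVec] at h1
    split_ifs at h1 with h
    · exact h1
    · have h2 := (Submodule.add_mem_iff_right _ (Submodule.smul_mem _ c hw)).1 h1
      -- At a descent the new permutation appears with coefficient c², whose inverse is c.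
      have h3 := Submodule.smul_mem _ c h2
      rwa [smul_smul, ← pow_succ', hc.cube_c, one_smul] at h3
  have hall : ∀ w : Equiv.Perm (Fin n), permVec k w ∈ LinearMap.range ev := by
    obtain ⟨m, rfl⟩ : ∃ m, n = m + 1 := ⟨n - 1, by omega⟩
    intro w
    have hw : w ∈ Submonoid.closure
        (Set.range fun i : Fin m => Equiv.swap i.castSucc i.succ) := by
      rw [Equiv.Perm.mclosure_swap_castSucc_succ]
      trivial
    induction hw using Submonoid.closure_induction_right with
    | one =>
      refine ⟨1, ?_⟩
      change ψ 1 (permVec k 1) = _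
      rw [map_one]
      rfl
    | mul_right x _ y hy hx =>
      obtain ⟨i, rfl⟩ := hy
      exact hswap i (by omega) x hx
  have hsurj : LinearMap.range ev = ⊤ := by
    rw [eq_top_iff, ← span_permVec, Submodule.span_le]
    rintro _ ⟨w, rfl⟩
    exact hall w
  have hle := LinearMap.finrank_range_le ev
  rw [hsurj, finrank_top, Module.finrank_finsupp_self, Fintype.card_perm, Fintype.card_fin] at hle
  exact hle

theorem finrank_hecke (hn : 3 ≤ n) (hc : CubeRoots a b c) :
    Module.finrank k (Hecke hn a b) = n.factorial :=
  le_antisymm (finrank_hecke_le hn hc) (factorial_le_finrank_hecke hn hc)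

end Dimension

/-! ### Kernels of characters as sums of Hecke ideals -/

section Glue

variable {k : Type*} [Field k] {n : ℕ} {a b c : k}

theorem algChar_algGen (ha : a ^ 3 = 1) {i : ℕ} (hi : i < n - 1) :
    algChar n a ha (algGen k n i) = a := by
  rw [algGen_eq ⟨i, hi⟩]
  exact algChar_gen a ha _

/-- The kernel of a character is the sum of the two Hecke ideals which it kills. -/
theorem mem_sup_of_algChar_eq_zero (hn : 3 ≤ n) (hc : CubeRoots a b c) (ha : a ^ 3 = 1)
    {x : MonoidAlgebra k (Γ n)} (hx : algChar n a ha x = 0) :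
    x ∈ heckeIdeal hn a b ⊔ heckeIdeal hn a c := by
  set I := heckeIdeal hn a b ⊔ heckeIdeal hn a c with hI
  set φ := quotMk k I with hφ
  set σ : ℕ → QuotAlg I := fun i => φ (algGen k n i) with hσ'
  have hσ : CubicBraid (n - 1) σ := (cubicBraid_algGen k n).map φ.toRingHom
  have hEc : eigIdem c (σ 0) = 0 := by
    rw [← map_eigIdem]
    refine quotMk_eq_zero I (TwoSidedIdeal.mem_sup_left ?_)
    rw [heckeIdeal_eq_span hn hc]
    exact TwoSidedIdeal.subset_span rfl
  have hEb : eigIdem b (σ 0) = 0 := by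
    rw [← map_eigIdem]
    refine quotMk_eq_zero I (TwoSidedIdeal.mem_sup_right ?_)
    rw [heckeIdeal_eq_span hn hc.swap.rotate]
    exact TwoSidedIdeal.subset_span rfl
  -- Modulo both ideals only the a-projection survives, so every generator is the scalar a and the
  -- quotient map factors through the character.
  have h0 : σ 0 = a • 1 := by
    have h1 := eigIdem_add hc (σ 0)
    have h2 := mul_decomp hc (hσ.cube 0 (by omega)) 1
    rw [hEb, hEc, add_zero, add_zero] at h1
    simpa only [hEb, hEc, h1, mul_one, smul_zero, add_zero] using h2
  have hi : ∀ i < n - 1, σ i = a • 1 := by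
    intro i hi
    rcases Nat.eq_zero_or_pos i with rfl | hpos
    · exact h0
    · obtain ⟨w, hw, h, -⟩ := hσ.exists_conj (i := i) (m := i - 1) (Or.inr (by omega)) hi
        (by omega)
      rw [h0, mul_smul_comm, mul_one] at h
      refine hw.mul_right_cancel ?_
      rw [← h, smul_mul_assoc, one_mul]
  have hEq : φ = (Algebra.ofId k _).comp (algChar n a ha) := by
    refine AlgHom.ext_of_adjoin_eq_top (adjoin_algGen k n) ?_
    rintro _ ⟨i, hin, rfl⟩
    rw [AlgHom.comp_apply, algChar_algGen ha hin, Algebra.ofId_apply,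
      Algebra.algebraMap_eq_smul_one]
    exact hi i hin
  rw [← quotMk_eq_zero_iff (k := k), ← hφ, hEq, AlgHom.comp_apply, hx, map_zero]

theorem exists_separating (hn : 3 ≤ n) (hc : CubeRoots a b c) (ha : a ^ 3 = 1) (hb : b ^ 3 = 1) :
    ∃ u, algChar n a ha u = 0 ∧ algChar n b hb u = 1 := by
  refine ⟨c ^ 2 • (algGen k n 0 - algebraMap k _ a), ?_, ?_⟩
  · rw [map_smul, map_sub, algChar_algGen ha (by omega), AlgHom.commutes]
    simp
  · rw [map_smul, map_sub, algChar_algGen hb (by omega), AlgHom.commutes, smul_eq_mul]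
    change c ^ 2 * (b - a) = 1
    rw [hc.swap.sub_ab, ← pow_succ, hc.cube_c]

theorem heckeIdeal_comm (hn : 3 ≤ n) (hc : CubeRoots a b c) :
    heckeIdeal hn a b = heckeIdeal hn b a := by
  rw [heckeIdeal_eq_span hn hc, heckeIdeal_eq_span hn hc.swap]

/-- Write I_ab for the Hecke ideals. A product, in either order, of elements of I_ab + I_ac and I_ab
+ I_bc lies in I_ab + (I_ac ∩ I_bc). The two kernels are comaximal, so their intersection is spanned
by such products, via x = ux + (1 - u)x. -/
theorem exists_add_of_algChar_eq_zero (hn : 3 ≤ n) (hc : CubeRoots a b c) (ha : a ^ 3 = 1)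
    (hb : b ^ 3 = 1) {x : MonoidAlgebra k (Γ n)} (hxa : algChar n a ha x = 0)
    (hxb : algChar n b hb x = 0) :
    ∃ v w, v ∈ heckeIdeal hn a c ∧ v ∈ heckeIdeal hn b c ∧ w ∈ heckeIdeal hn a b ∧ x = v + w := by
  have prod_mem : ∀ u v, algChar n a ha u = 0 → algChar n b hb v = 0 →
      (∃ y w, y ∈ heckeIdeal hn a c ∧ y ∈ heckeIdeal hn b c ∧ w ∈ heckeIdeal hn a b ∧
        u * v = y + w) ∧
      (∃ y w, y ∈ heckeIdeal hn a c ∧ y ∈ heckeIdeal hn b c ∧ w ∈ heckeIdeal hn a b ∧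
        v * u = y + w) := by
    intro u v hu hv
    obtain ⟨u₁, hu₁, u₂, hu₂, rfl⟩ :=
      TwoSidedIdeal.mem_sup.1 (mem_sup_of_algChar_eq_zero hn hc ha hu)
    obtain ⟨v₁, hv₁, v₂, hv₂, rfl⟩ :=
      TwoSidedIdeal.mem_sup.1 (mem_sup_of_algChar_eq_zero hn hc.swap hb hv)
    rw [← heckeIdeal_comm hn hc] at hv₁
    constructor
    · refine ⟨u₂ * v₂, u₁ * (v₁ + v₂) + u₂ * v₁, TwoSidedIdeal.mul_mem_right _ _ _ hu₂,
        TwoSidedIdeal.mul_mem_left _ _ _ hv₂,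
        add_mem (TwoSidedIdeal.mul_mem_right _ _ _ hu₁) (TwoSidedIdeal.mul_mem_left _ _ _ hv₁), ?_⟩
      rw [add_mul, mul_add u₂]
      abel
    · refine ⟨v₂ * u₂, (v₁ + v₂) * u₁ + v₁ * u₂, TwoSidedIdeal.mul_mem_left _ _ _ hu₂,
        TwoSidedIdeal.mul_mem_right _ _ _ hv₂,
        add_mem (TwoSidedIdeal.mul_mem_left _ _ _ hu₁) (TwoSidedIdeal.mul_mem_right _ _ _ hv₁), ?_⟩
      rw [mul_add, add_mul v₁ v₂ u₂]
      abel
  obtain ⟨u, hua, hub⟩ := exists_separating hn hc ha hb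
  obtain ⟨y₁, w₁, h1, h2, h3, e1⟩ := (prod_mem u x hua hxb).1
  obtain ⟨y₂, w₂, h4, h5, h6, e2⟩ := (prod_mem x (1 - u) hxa (by rw [map_sub, map_one, hub,
    sub_self])).2
  refine ⟨y₁ + y₂, w₁ + w₂, add_mem h1 h4, add_mem h2 h5, add_mem h3 h6, ?_⟩
  have : x = u * x + (1 - u) * x := by rw [sub_mul, one_mul]; abel
  rw [this, e1, e2]
  abel

end Glue

/-! ### The image of the diagonal map, its dimension, and **q** -/

section Fibre

variable {k : Type*} [Field k] {n : ℕ} {j : k}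

theorem cubeRoots [CharP k 2] (hj : j ^ 2 + j + 1 = 0) : CubeRoots 1 j (j ^ 2) where
  two := CharTwo.two_eq_zero
  sum := by linear_combination hj
  prod_ab := by linear_combination (j - j ^ 2) * hj
  prod_bc := by linear_combination (j - 1) * hj
  prod_ca := by ring
  cube_a := one_pow 3
  cube_b := cube_eq_one hj
  cube_c := sq_cube_eq_one hj

theorem heckeChar_quotMk (hn : 3 ≤ n) (α β γ : k) (hγ : γ ^ 3 = 1)
    (hroot : (γ - α) * (γ - β) = 0) (x : MonoidAlgebra k (Γ n)) :
    heckeChar hn α β γ hγ hroot (quotMk k _ x) = algChar n γ hγ x := rfl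

theorem diag_mem (hn : 3 ≤ n) (hj : j ^ 2 + j + 1 = 0) (x : MonoidAlgebra k (Γ n)) :
    diag hn j x ∈ ternaryHecke hn j hj := ⟨rfl, rfl, rfl⟩

/-- A Chinese remainder argument: glue the first two components along the character with value j²,
then correct the third. -/
theorem exists_diag_eq [CharP k 2] (hn : 3 ≤ n) (hj : j ^ 2 + j + 1 = 0) {t : HeckeProd hn j}
    (ht : t ∈ ternaryHecke hn j hj) : ∃ x, diag hn j x = t := by
  have hc := cubeRoots hj
  obtain ⟨x, y, z⟩ := t
  obtain ⟨x, rfl⟩ := quotMk_surjective (k := k) _ x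
  obtain ⟨y, rfl⟩ := quotMk_surjective (k := k) _ y
  obtain ⟨z, rfl⟩ := quotMk_surjective (k := k) _ z
  obtain ⟨h1, h2, h3⟩ := ht
  simp only [heckeChar_quotMk] at h1 h2 h3
  have hxy : algChar n (j ^ 2) (sq_cube_eq_one hj) (x - y) = 0 := by rw [map_sub, h3, sub_self]
  obtain ⟨p, hp, r, hr, hpr⟩ := TwoSidedIdeal.mem_sup.1
    (mem_sup_of_algChar_eq_zero hn hc.swap.rotate.rotate (sq_cube_eq_one hj) hxy)
  rw [← heckeIdeal_comm hn hc.rotate] at hp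
  rw [← heckeIdeal_comm hn hc.swap.rotate] at hr
  have hxp : x - p = y + r := by
    rw [sub_eq_iff_eq_add, add_assoc, add_comm r, hpr]
    abel
  have e1 : algChar n 1 (one_pow 3) (z - (x - p)) = 0 := by
    rw [hxp, map_sub, map_add, algChar_eq_zero hn 1 (j ^ 2) 1 (one_pow 3) (by simp) r hr, h1,
      add_zero, sub_self]
  have e2 : algChar n j (cube_eq_one hj) (z - (x - p)) = 0 := by
    rw [map_sub, map_sub, algChar_eq_zero hn j (j ^ 2) j (cube_eq_one hj) (by simp) p hp, h2,
      sub_zero, sub_self]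
  -- Adding v to x - p leaves the first two components unchanged and corrects the third modulo its
  -- Hecke ideal.
  obtain ⟨v, w, hv1, hv2, hw, hvw⟩ :=
    exists_add_of_algChar_eq_zero hn hc (one_pow 3) (cube_eq_one hj) e1 e2
  have f1 : x - p + v - x ∈ heckeIdeal hn j (j ^ 2) := by
    rw [show x - p + v - x = v - p by abel]
    exact sub_mem hv2 hp
  have f2 : x - p + v - y ∈ heckeIdeal hn 1 (j ^ 2) := by
    rw [hxp, show y + r + v - y = r + v by abel]
    exact add_mem hr hv1
  have f3 : x - p + v - z ∈ heckeIdeal hn 1 j := by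
    rw [show x - p + v - z = v - (z - (x - p)) by abel, hvw, sub_add_cancel_left]
    exact neg_mem hw
  refine ⟨x - p + v, Prod.ext ?_ (Prod.ext ?_ ?_)⟩
  · exact sub_eq_zero.1 ((map_sub _ _ _).symm.trans ((quotMk_eq_zero_iff _).2 f1))
  · exact sub_eq_zero.1 ((map_sub _ _ _).symm.trans ((quotMk_eq_zero_iff _).2 f2))
  · exact sub_eq_zero.1 ((map_sub _ _ _).symm.trans ((quotMk_eq_zero_iff _).2 f3))

theorem natMap_injective (hn : 3 ≤ n) (j : k) : Function.Injective (natMap hn j) := by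
  rw [injective_iff_map_eq_zero]
  intro x hx
  obtain ⟨x, rfl⟩ := quotMk_surjective (k := k) _ x
  replace hx : diag hn j x = 0 := hx
  refine (quotMk_eq_zero_iff _).2 ?_
  rw [J, TwoSidedIdeal.mem_inf, TwoSidedIdeal.mem_inf]
  exact ⟨⟨(quotMk_eq_zero_iff (k := k) _).1 (congrArg (fun t => t.2.2) hx),
    (quotMk_eq_zero_iff (k := k) _).1 (congrArg (fun t => t.2.1) hx)⟩,
    (quotMk_eq_zero_iff (k := k) _).1 (congrArg Prod.fst hx)⟩

theorem range_natMap [CharP k 2] (hn : 3 ≤ n) (hj : j ^ 2 + j + 1 = 0) :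
    (natMap hn j).range = ternaryHecke hn j hj := by
  apply le_antisymm
  · rintro _ ⟨x, rfl⟩
    obtain ⟨x, rfl⟩ := quotMk_surjective (k := k) _ x
    exact diag_mem hn hj x
  · intro t ht
    obtain ⟨x, rfl⟩ := exists_diag_eq hn hj ht
    exact ⟨quotMk k _ x, rfl⟩

/-- The differences of the common one-dimensional quotients of the three Hecke algebras. -/
noncomputable def charDiff (hn : 3 ≤ n) (hj : j ^ 2 + j + 1 = 0) :
    HeckeProd hn j →ₗ[k] k × k × k where
  toFun t := (heckeChar hn 1 (j ^ 2) 1 (one_pow 3) (by simp) t.2.1 -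
      heckeChar hn 1 j 1 (one_pow 3) (by simp) t.2.2,
    heckeChar hn j (j ^ 2) j (cube_eq_one hj) (by simp) t.1 -
      heckeChar hn 1 j j (cube_eq_one hj) (by simp) t.2.2,
    heckeChar hn j (j ^ 2) (j ^ 2) (sq_cube_eq_one hj) (by simp) t.1 -
      heckeChar hn 1 (j ^ 2) (j ^ 2) (sq_cube_eq_one hj) (by simp) t.2.1)
  map_add' s t := by
    simp only [Prod.fst_add, Prod.snd_add, map_add, Prod.mk_add_mk, Prod.mk.injEq]
    exact ⟨by ring, by ring, by ring⟩
  map_smul' d t := by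
    simp only [Prod.smul_fst, Prod.smul_snd, map_smul, Prod.smul_mk, RingHom.id_apply, smul_sub]

theorem ker_charDiff (hn : 3 ≤ n) (hj : j ^ 2 + j + 1 = 0) :
    LinearMap.ker (charDiff hn hj) = Subalgebra.toSubmodule (ternaryHecke hn j hj) := by
  ext t
  rw [LinearMap.mem_ker]
  simp only [charDiff, LinearMap.coe_mk, AddHom.coe_mk, Prod.mk_eq_zero, sub_eq_zero]
  rfl

theorem range_charDiff [CharP k 2] (hn : 3 ≤ n) (hj : j ^ 2 + j + 1 = 0) :
    LinearMap.range (charDiff hn hj) = ⊤ := by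
  have hc := cubeRoots hj
  rw [LinearMap.range_eq_top]
  rintro ⟨α, β, γ⟩
  obtain ⟨u, hu, hu'⟩ := exists_separating hn hc.swap.rotate.rotate (sq_cube_eq_one hj)
    (cube_eq_one hj)
  obtain ⟨v, hv, hv'⟩ := exists_separating hn hc.rotate (cube_eq_one hj) (sq_cube_eq_one hj)
  obtain ⟨w, hw, hw'⟩ := exists_separating hn hc.swap.rotate.swap (sq_cube_eq_one hj) (one_pow 3)
  -- u, v and w take the value 1 at j, j² and 1 respectively, and the value 0 at the other character
  -- of their component; the third component is not needed.
  refine ⟨(quotMk k _ (β • u + γ • v), quotMk k _ (α • w), 0), ?_⟩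
  simp only [charDiff, LinearMap.coe_mk, AddHom.coe_mk, heckeChar_quotMk, map_zero, map_add,
    map_smul, hu, hu', hv, hv', hw, hw', smul_eq_mul, mul_one, mul_zero, add_zero, zero_add,
    sub_zero]

theorem finrank_ternaryHecke [CharP k 2] (hn : 3 ≤ n) (hj : j ^ 2 + j + 1 = 0) :
    Module.Finite k (ternaryHecke hn j hj) ∧
      Module.finrank k (ternaryHecke hn j hj) = 3 * (n.factorial - 1) := by
  have hc := cubeRoots hj
  have := finite_hecke hn hc
  have := finite_hecke hn hc.rotate
  have := finite_hecke hn hc.swap.rotate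
  refine ⟨inferInstanceAs (Module.Finite k (Subalgebra.toSubmodule (ternaryHecke hn j hj))), ?_⟩
  have h := LinearMap.finrank_range_add_finrank_ker (charDiff hn hj)
  rw [range_charDiff, ker_charDiff, finrank_top, Subalgebra.finrank_toSubmodule,
    Module.finrank_prod, Module.finrank_prod, Module.finrank_prod, Module.finrank_prod,
    finrank_hecke hn hc, finrank_hecke hn hc.rotate, finrank_hecke hn hc.swap.rotate,
    Module.finrank_self] at h
  omega

theorem q_mem_J [CharP k 2] (hn : 3 ≤ n) (hj : j ^ 2 + j + 1 = 0) : q k hn ∈ J hn j := by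
  have hc := cubeRoots hj
  rw [J, TwoSidedIdeal.mem_inf, TwoSidedIdeal.mem_inf]
  exact ⟨⟨q_mem_heckeIdeal hn hc, q_mem_heckeIdeal hn hc.swap.rotate⟩,
    q_mem_heckeIdeal hn hc.rotate⟩

end Fibre

end TernaryHecke

theorem theorem5p2 {k : Type*} [Field k] [CharP k 2] (j : k) (hj : j ^ 2 + j + 1 = 0)
    (n : ℕ) (hn : 3 ≤ n) :
    -- `J_n` is generated by `b`
    TernaryHecke.J hn j = TwoSidedIdeal.span {TernaryHecke.b k hn} ∧
    -- the dimension of `kΓ_n / J_n`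
    Module.Finite k (TernaryHecke.QuotAlg (TernaryHecke.J hn j)) ∧
    Module.finrank k (TernaryHecke.QuotAlg (TernaryHecke.J hn j)) = 3 * (n.factorial - 1) ∧
    -- the natural map embeds `kΓ_n / J_n` in the product of the Hecke algebras, with image `𝓗_n`
    Function.Injective (TernaryHecke.natMap hn j) ∧
    (TernaryHecke.natMap hn j).range = TernaryHecke.ternaryHecke hn j hj ∧
    -- the dimension of `𝓗_n`
    Module.Finite k (TernaryHecke.ternaryHecke hn j hj) ∧
    Module.finrank k (TernaryHecke.ternaryHecke hn j hj) = 3 * (n.factorial - 1) ∧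
    -- `K_n` maps onto `𝓗_n`, compatibly with the maps from `kΓ_n`
    ∃ π : TernaryHecke.K k hn →ₐ[k] TernaryHecke.ternaryHecke hn j hj,
      Function.Surjective π ∧
      ∀ x : MonoidAlgebra k (TernaryHecke.Γ n),
        (π (TernaryHecke.quotMk k _ x) : TernaryHecke.HeckeProd hn j) =
          TernaryHecke.diag hn j x := by
  have hinj := TernaryHecke.natMap_injective hn j
  have hrange := TernaryHecke.range_natMap hn hj
  obtain ⟨hfin, hdim⟩ := TernaryHecke.finrank_ternaryHecke hn hj
  have e : TernaryHecke.QuotAlg (TernaryHecke.J hn j) ≃ₗ[k] TernaryHecke.ternaryHecke hn j hj :=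
    hrange ▸ (AlgEquiv.ofInjective _ hinj).toLinearEquiv
  have hq : ∀ x ∈ TwoSidedIdeal.span {TernaryHecke.q k hn},
      (TernaryHecke.diag hn j).codRestrict (TernaryHecke.ternaryHecke hn j hj)
        (TernaryHecke.diag_mem hn hj) x = 0 := by
    intro x hx
    refine Subtype.ext (TernaryHecke.diag_eq_zero hn j x ?_)
    refine TwoSidedIdeal.span_le.2 ?_ hx
    rintro _ rfl
    exact TernaryHecke.q_mem_J hn hj
  refine ⟨TernaryHecke.inf_eq_span_b hn (TernaryHecke.cubeRoots hj), Module.Finite.equiv e.symm,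
    e.finrank_eq.trans hdim, hinj, hrange, hfin, hdim,
    TernaryHecke.quotLift k _ _ hq, ?_, fun x => rfl⟩
  rintro ⟨t, ht⟩
  obtain ⟨x, rfl⟩ := TernaryHecke.exists_diag_eq hn hj ht
  exact ⟨TernaryHecke.quotMk k _ x, rfl⟩
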